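/- **Algorithm.** Let $\tau\ge 1$ be an integer and $a_1<0,a_2,\dots,a_7$ rational numbers. Write $(t)_k=t(t-1)\cdots(t-k+1)$, and for $v_1,\dots,v_k$ in a commutative ring put $$S_k(m,r;v_1,\dots,v_k)=\sum \frac{r!}{n_1!\cdots n_k!}\,v_1^{n_1}\cdots v_k^{n_k},$$ the sum being over all integers $n_1,\dots,n_k\ge 0$ with $n_1+2n_2+\cdots+kn_k=m$ and $n_1+\cdots+n_k=r$. Define $\lambda=-1/(\tau a_1)$ and $$b_j=\lambda^{j+1}\sum_{s=0}^{j}\frac{(-\tau)_{j+1-s}}{(j+1-s)!}S_7(j+1,j+1-s;a_1,\dots,a_7)\quad(1\le j\le 6),$$ $$a_{0,j}=\sum_{s=0}^{j-1}\frac{(-1)^{j-1-s}}{j-s}S_7(j,j-s;1,b_1,\dots,b_6)\quad(1\le j\le 6),$$ $$a_{i,j}=\sum_{s=0}^{j-i-1}\frac{(-i)_{j-i-s}}{(j-i-s)!}S_7(j-i,j-i-s;1,b_1,\dots,b_6)\quad(1\le i<j\le 6),$$ $$c_0=-b_1,\qquad c_i=\frac1i\Bigl(b_{i+1}+\sum_{h=0}^{i-1}a_{h,i+1}c_h\Bigr)\quad(1\le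 i\le5),$$ the polynomials $T_1=X$ and, for $1\le m\le 5$, $$T_{m+1}=b_1\sum_{s=0}^{m-1}\frac{(-1)^{m-1-s}}{m-s}S_m(m,m-s;T_1,\dots,T_m)-c_m-\sum_{p=1}^{m-1}c_p\sum_{q=1}^{m-p}\frac{(-p)_q}{q!}S_m(m-p,q;T_1,\dots,T_m),$$ $\widetilde T_m(X)=T_m(-\tau X)$, and the polynomials $P_0=1$, $P_1=X$ and, for $2\le m\le 6$, $$P_m=\sum_{s=0}^{m-1}\frac{(-1/\tau)_{m-s}}{(m-s)!}S_6(m,m-s;\widetilde T_1,\dots,\widetilde T_6).$$ **Theorem.** (1) As $x\to0$, $\tanh x=x+\sum_{m=1}^7a_mx^{2m+1}+O(x^{17})$ with $$(a_1,\dots,a_7)=\Bigl(-\tfrac13,\tfrac2{15},-\tfrac{17}{315},\tfrac{62}{2835},-\tfrac{1382}{155925},\tfrac{21844}{6081075},-\tfrac{929569}{638512875}\Bigr).$$ For these numbers and $\tau=2$ the algorithm gives $\lambda=\tfrac32$, $$(b_1,\dots,b_6)=\Bigl(\tfrac3{20},-\tfrac1{28},\tfrac3{400},-\tfrac9{6160},\tfrac{691}{2548000},-\tfrac3{61600}\Bigr),$$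 $$(a_{0,1},\dots,a_{0,6})=\Bigl(1,-\tfrac7{20},\tfrac{31}{210},-\tfrac{381}{5600},\tfrac{73}{2200},-\tfrac{1414477}{84084000}\Bigr),$$ $$(c_1,\dots,c_5)=\Bigl(\tfrac{47}{2800},-\tfrac3{16000},-\tfrac{83723}{86240000},-\tfrac{27832729}{89689600000},\tfrac{2800730629}{15695680000000}\Bigr),$$ $$T_2=\tfrac3{20}X-\tfrac{47}{2800},\qquad T_3=-\tfrac3{40}X^2+\tfrac{11}{280}X-\tfrac{261}{112000},$$ $$T_4=\tfrac1{20}X^3-\tfrac{283}{5600}X^2+\tfrac{591}{56000}X+\tfrac{58557}{172480000},$$ $$P_2=\tfrac32X^2+\tfrac3{20}X+\tfrac{47}{5600},\qquad P_3=\tfrac52X^3+\tfrac35X^2+\tfrac{361}{5600}X+\tfrac{261}{224000},$$ $$P_4=\tfrac{35}8X^4+\tfrac{71}{40}X^3+\tfrac{101}{320}X^2+\tfrac{3993}{224000}X-\tfrac{44217}{689920000}.$$ (2) For every $x_0>0$ there is a real constant $C=C(x_0)$ such that the sequence $x_n=\tanh(x_{n-1})$, $n\ge1$, satisfies, with these data,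 as $n\to\infty$, $$x_n=\Bigl(\frac{\lambda}{n}\Bigr)^{1/\tau}\Bigl\{1+\sum_{m=1}^4P_m\Bigl(-\tfrac1\tau\bigl[b_1\ln n+C\bigr]\Bigr)\frac1{n^m}\Bigr\}+o(n^{-9/2})\qquad\text{(A)}$$ and, explicitly, $$\frac{x_n}{\sqrt{3/2}}=\sum_{m=0}^4(-1)^m\frac{Q_m(\ln n,C)}{n^{m+1/2}}+o(n^{-9/2}),$$ where $$Q_0=1,\qquad Q_1=\tfrac3{40}L+\tfrac C2,\qquad Q_2=\tfrac{27}{3200}L^2+\bigl(\tfrac9{80}C-\tfrac9{800}\bigr)L+\bigl(\tfrac38C^2-\tfrac3{40}C+\tfrac{47}{5600}\bigr),$$ $$Q_3=\tfrac{27}{25600}L^3+\bigl(\tfrac{27}{1280}C-\tfrac{27}{8000}\bigr)L^2+\bigl(\tfrac9{64}C^2-\tfrac9{200}C+\tfrac{1083}{224000}\bigr)L+\bigl(\tfrac5{16}C^3-\tfrac3{20}C^2+\tfrac{361}{11200}C-\tfrac{261}{224000}\bigr),$$ $$\begin{aligned}Q_4={}&\tfrac{567}{4096000}L^4+\bigl(\tfrac{189}{51200}C-\tfrac{1917}{2560000}\bigr)L^3+\bigl(\tfrac{189}{5120}C^2-\tfrac{1917}{128000}C+\tfrac{909}{512000}\bigr)L^2\\&+\bigl(\tfrac{21}{128}C^3-\tfrac{639}{6400}C^2+\tfrac{303}{12800}C-\tfrac{11979}{8960000}\bigr)L\\&+\bigl(\tfrac{35}{128}C^4-\tfrac{71}{320}C^3+\tfrac{101}{1280}C^2-\tfrac{3993}{448000}C-\tfrac{44217}{689920000}\bigr),\end{aligned}$$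 with $Q_m=Q_m(L,C)$. (3) As $x\to0$, $\arctan x=x+\sum_{m=1}^7\frac{(-1)^m}{2m+1}x^{2m+1}+O(x^{17})$. For every $x_0>0$ there is a real constant $C=C(x_0)$ (in general different from that in (2)) such that the sequence $x_n=\arctan(x_{n-1})$, $n\ge1$, satisfies, as $n\to\infty$, formula (A) with $C$ replaced by $-C$ and with $\lambda$, $b_1$, $P_m$ computed from $\tau=2$ and $a_m=(-1)^m/(2m+1)$, and $$\frac{x_n}{\sqrt{3/2}}=\sum_{m=0}^4\frac{Q_m(\ln n,C)}{n^{m+1/2}}+o(n^{-9/2})$$ with the same polynomials $Q_m$. (4) All corresponding coefficients for $\tanh$ and for $\arctan$ agree up to sign: $c_i^{\tanh}=(-1)^{i+1}c_i^{\arctan}$ for $1\le i\le5$; for $1\le m\le4$ and $k\ge0$ the coefficients of $X^k$ satisfy $[X^k]T_m^{\tanh}=(-1)^{m+k}[X^k]T_m^{\arctan}$ and $[X^k]P_m^{\tanh}=(-1)^{m+k}[X^k]P_m^{\arctan}$; and the coefficient of $(\ln n)^j/n^{m+1/2}$ in the expansion in (2), as a polynomial in $C$, is $(-1)^m$ times that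 in the expansion in (3). -/

import Mathlib

open Filter Topology Asymptotics Polynomial

noncomputable section

namespace Iterates

/-! ### The expansion algorithm

The input is a gap `τ ≥ 1` and the coefficients `a 1, …, a 7` (with `a 1 < 0`) of a function
`f(x) = x + ∑ a m * x ^ (m * τ + 1) + ⋯`. Values of `a` outside `1, …, 7` are never used. -/

/-- `f(x) = x + ∑_{m=1}^{7} a m * x ^ (m * τ + 1) + O(x ^ (8 * τ + 1))` as `x → 0`: the Taylor series
of (the smooth function) `f` at the origin starts in this way. -/
def TaylorStart (f : ℝ → ℝ) (τ : ℕ) (a : ℕ → ℚ) : Prop :=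
  (fun x : ℝ => f x - (x + ∑ m ∈ Finset.Icc 1 7, (a m : ℝ) * x ^ (m * τ + 1)))
    =O[𝓝 0] fun x : ℝ => x ^ (8 * τ + 1)

/-- The falling product `t (t - 1) ⋯ (t - k + 1)`. -/
def falling (t : ℚ) (k : ℕ) : ℚ := ∏ i ∈ Finset.range k, (t - i)

/-- The sum over all `n₁, …, n_k ≥ 0` with `n₁ + 2 n₂ + ⋯ + k n_k = m` and `n₁ + ⋯ + n_k = r` of the
multinomial coefficient `r! / (n₁! ⋯ n_k!)` times `v₁ ^ n₁ ⋯ v_k ^ n_k`.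
(The index `i : Fin k` stands for `i + 1`, and `r` for `m - s`.) -/
def partSum {R : Type} [CommRing R] (k m r : ℕ) (v : Fin k → R) : R :=
  ∑ n ∈ (Finset.Nat.antidiagonalTuple k r).filter
      (fun n => ∑ i : Fin k, ((i : ℕ) + 1) * n i = m),
    (Nat.multinomial Finset.univ n : R) * ∏ i : Fin k, v i ^ n i

/-- `λ = -1 / (τ a₁)`. -/
def lam (τ : ℕ) (a : ℕ → ℚ) : ℚ := -1 / (τ * a 1)

/-- The numbers `b_j`, `j ≥ 1`. -/
def coeffB (τ : ℕ) (a : ℕ → ℚ) (j : ℕ) : ℚ :=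
  lam τ a ^ (j + 1) * ∑ s ∈ Finset.range (j + 1),
    falling (-τ) (j + 1 - s) / (j + 1 - s).factorial *
      partSum 7 (j + 1) (j + 1 - s) (fun i : Fin 7 => a ((i : ℕ) + 1))

/-- The tuple `(1, b₁, …, b₆)`. -/
def oneB (τ : ℕ) (a : ℕ → ℚ) : Fin 7 → ℚ :=
  fun i => if (i : ℕ) = 0 then 1 else coeffB τ a i

/-- The numbers `a_{0,j}` (`j ≥ 1`) and `a_{i,j}` (`1 ≤ i < j`). -/
def coeffA (τ : ℕ) (a : ℕ → ℚ) (i j : ℕ) : ℚ :=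
  if i = 0 then
    ∑ s ∈ Finset.range j,
      (-1) ^ (j - 1 - s) / ((j - s : ℕ) : ℚ) * partSum 7 j (j - s) (oneB τ a)
  else
    ∑ s ∈ Finset.range (j - i),
      falling (-i) (j - i - s) / (j - i - s).factorial *
        partSum 7 (j - i) (j - i - s) (oneB τ a)

/-- The numbers `c_i`: `c₀ = -b₁` and `c_i = (b_{i+1} + ∑_{h<i} a_{h,i+1} c_h) / i`. -/
def coeffC (τ : ℕ) (a : ℕ → ℚ) : ℕ → ℚ
  | 0 => -coeffB τ a 1
  | i + 1 => (1 / ((i + 1 : ℕ) : ℚ)) *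
      (coeffB τ a (i + 2) + ∑ h : Fin (i + 1), coeffA τ a h (i + 2) * coeffC τ a h)

/-- The polynomials `T_m`, `m ≥ 1`: `T₁ = X` and, for `m ≥ 1`, `T_{m+1}` is obtained from
`T₁, …, T_m`. (For `m = 1` the recursion reads `T₂ = b₁ X - c₁`.) -/
def polyT (τ : ℕ) (a : ℕ → ℚ) : ℕ → ℚ[X]
  | 0 => 0
  | 1 => X
  | m + 2 =>
      C (coeffB τ a 1) * ∑ s ∈ Finset.range (m + 1),
          C ((-1) ^ (m - s) / ((m + 1 - s : ℕ) : ℚ)) *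
            partSum (m + 1) (m + 1) (m + 1 - s) (fun i : Fin (m + 1) => polyT τ a ((i : ℕ) + 1))
        - C (coeffC τ a (m + 1))
        - ∑ p ∈ Finset.Icc 1 m, C (coeffC τ a p) *
            ∑ q ∈ Finset.Icc 1 (m + 1 - p), C (falling (-p) q / q.factorial) *
              partSum (m + 1) (m + 1 - p) q (fun i : Fin (m + 1) => polyT τ a ((i : ℕ) + 1))

/-- `T̃_m(X) = T_m(-τ X)`. -/
def polyTt (τ : ℕ) (a : ℕ → ℚ) (m : ℕ) : ℚ[X] := (polyT τ a m).comp (C (-(τ : ℚ)) * X)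

/-- The polynomials `P_m`, `0 ≤ m ≤ 6`. -/
def polyP (τ : ℕ) (a : ℕ → ℚ) (m : ℕ) : ℚ[X] :=
  if m = 0 then 1
  else if m = 1 then X
  else ∑ s ∈ Finset.range m,
    C (falling (-1 / τ) (m - s) / (m - s).factorial) *
      partSum 6 m (m - s) (fun i : Fin 6 => polyTt τ a ((i : ℕ) + 1))

/-- `(λ / n) ^ (1/τ) * (1 + ∑_{m=1}^{M} P_m(-(1/τ) (b₁ ln n + K)) / n ^ m)`. -/
def formulaSum (τ : ℕ) (a : ℕ → ℚ) (M : ℕ) (K : ℝ) (n : ℕ) : ℝ :=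
  ((lam τ a : ℝ) / n) ^ (1 / (τ : ℝ)) *
    (1 + ∑ m ∈ Finset.Icc 1 M,
      aeval (-(1 / (τ : ℝ)) * ((coeffB τ a 1 : ℝ) * Real.log n + K)) (polyP τ a m) / (n : ℝ) ^ m)

/-! ### Hyperbolic tangent and inverse circular tangent -/

/-- The Taylor coefficients of `tanh` at `x ^ (2 * m + 1)`, `1 ≤ m ≤ 7`. -/
def tanhA : ℕ → ℚ
  | 1 => -1 / 3
  | 2 => 2 / 15
  | 3 => -17 / 315
  | 4 => 62 / 2835
  | 5 => -1382 / 155925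
  | 6 => 21844 / 6081075
  | 7 => -929569 / 638512875
  | _ => 0

/-- The Taylor coefficients of `arctan` at `x ^ (2 * m + 1)`, `1 ≤ m ≤ 7`. -/
def arctanA : ℕ → ℚ
  | 1 => -1 / 3
  | 2 => 1 / 5
  | 3 => -1 / 7
  | 4 => 1 / 9
  | 5 => -1 / 11
  | 6 => 1 / 13
  | 7 => -1 / 15
  | _ => 0

/-- The coefficient of `(ln n) ^ j / n ^ (m + 1/2)` in the expansion for `tanh`, as a function
of the constant `K`. -/
def tanhCoeff (K : ℝ) : ℕ → ℕ → ℝ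
  | 0, 0 => 1
  | 1, 1 => -(3 / 40)
  | 1, 0 => -(K / 2)
  | 2, 2 => 27 / 3200
  | 2, 1 => 9 / 80 * K - 9 / 800
  | 2, 0 => 3 / 8 * K ^ 2 - 3 / 40 * K + 47 / 5600
  | 3, 3 => -(27 / 25600)
  | 3, 2 => -(27 / 1280 * K - 27 / 8000)
  | 3, 1 => -(9 / 64 * K ^ 2 - 9 / 200 * K + 1083 / 224000)
  | 3, 0 => -(5 / 16 * K ^ 3 - 3 / 20 * K ^ 2 + 361 / 11200 * K - 261 / 224000)
  | 4, 4 => 567 / 4096000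
  | 4, 3 => 189 / 51200 * K - 1917 / 2560000
  | 4, 2 => 189 / 5120 * K ^ 2 - 1917 / 128000 * K + 909 / 512000
  | 4, 1 => 21 / 128 * K ^ 3 - 639 / 6400 * K ^ 2 + 303 / 12800 * K - 11979 / 8960000
  | 4, 0 => 35 / 128 * K ^ 4 - 71 / 320 * K ^ 3 + 101 / 1280 * K ^ 2 - 3993 / 448000 * K
      - 44217 / 689920000
  | _, _ => 0

/-- The coefficient of `(ln n) ^ j / n ^ (m + 1/2)` in the expansion for `arctan`, as a function
of the constant `K`. -/
def arctanCoeff (K : ℝ) : ℕ → ℕ → ℝ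
  | 0, 0 => 1
  | 1, 1 => 3 / 40
  | 1, 0 => K / 2
  | 2, 2 => 27 / 3200
  | 2, 1 => 9 / 80 * K - 9 / 800
  | 2, 0 => 3 / 8 * K ^ 2 - 3 / 40 * K + 47 / 5600
  | 3, 3 => 27 / 25600
  | 3, 2 => 27 / 1280 * K - 27 / 8000
  | 3, 1 => 9 / 64 * K ^ 2 - 9 / 200 * K + 1083 / 224000
  | 3, 0 => 5 / 16 * K ^ 3 - 3 / 20 * K ^ 2 + 361 / 11200 * K - 261 / 224000
  | 4, 4 => 567 / 4096000
  | 4, 3 => 189 / 51200 * K - 1917 / 2560000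
  | 4, 2 => 189 / 5120 * K ^ 2 - 1917 / 128000 * K + 909 / 512000
  | 4, 1 => 21 / 128 * K ^ 3 - 639 / 6400 * K ^ 2 + 303 / 12800 * K - 11979 / 8960000
  | 4, 0 => 35 / 128 * K ^ 4 - 71 / 320 * K ^ 3 + 101 / 1280 * K ^ 2 - 3993 / 448000 * K
      - 44217 / 689920000
  | _, _ => 0

/-- `∑_{m=0}^{4} ∑_{j=0}^{m} w m j * (ln n) ^ j / n ^ (m + 1/2)`. -/
def expansion (w : ℕ → ℕ → ℝ) (n : ℕ) : ℝ :=
  ∑ m ∈ Finset.range 5, ∑ j ∈ Finset.range (m + 1),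
    w m j * Real.log n ^ j / (n : ℝ) ^ ((m : ℝ) + 1 / 2)

end Iterates

end

/-! In the coordinate `y = 3 / (2 x²)`, that is `λ / x ^ τ`, both maps become `y ↦ y + 1 + b₁ / y +
⋯` near infinity. Abel's equation `A (F y) = A y + 1` linearises such a map, and its formal solution
is `A y = y - b₁ ln y + c₁ / y + c₂ / y² + ⋯`. Cut off after `c₃ / y³` (`abelFun`), it still
satisfies the equation up to an error of order `y⁻⁵` (`abelFun_diff_ord`).

Along an orbit this gives first `yₙ ~ n`, and then that the differences of `A yₙ - n` are `O(n ^
(-9/2))`. They are summable, so `A yₙ = n + K + o(n⁻³)` (`exists_abelFun_iterate`). The constant of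
the theorem is this `K`, with its sign changed for `arctan`.

It remains to invert `A`. With `v = 1 + ∑ P_m / n ^ m`, the candidate `zₙ = n / v²` also satisfies
`A zₙ = n + K + o(n⁻³)` (`abelFun_series`). The derivative of `A` tends to `1` at infinity, so `yₙ -
zₙ = o(n⁻³)` (`exists_abelFun_expanding`), and taking inverse square roots improves this to `o(n ^
(-9/2))` for `xₙ` (`isLittleO_sub_of_inv_sq`).

The two substitutions into `A` are computations with power series truncated after the fifth power
(`HasJet`). The second has coefficients polynomial in `ln n`, so orders are measured up to
arbitrarily small powers (`Ord`). The algorithm is not proved correct in general: it is evaluated on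
the two inputs, and the resulting numbers are then verified directly in Abel's equation. -/

namespace Iterates

/-! ### The sums `S_k`: reduction to a recursion over compositions, and closed forms. -/

section PartSum

variable {R : Type} [CommRing R]

/-- The sum of `v i₁ ⋯ v i_r` over all compositions `i₁ + ⋯ + i_r = m` into positive parts. -/
def compSum (v : ℕ → R) : ℕ → ℕ → R
  | 0, m => if m = 0 then 1 else 0
  | r + 1, m => ∑ i ∈ Finset.range m, v (i + 1) * compSum v r (m - (i + 1))

/-- The multinomial theorem; the weight `n₁ + 2 n₂ + ⋯` is the exponent of `X`. -/
theorem partSum_eq_coeff (k m r : ℕ) (v : Fin k → R) :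
    partSum k m r v = ((∑ i : Fin k, C (v i) * X ^ ((i : ℕ) + 1)) ^ r : R[X]).coeff m := by
  rw [Finset.sum_pow_eq_sum_piAntidiag, Finset.piAntidiag_univ_fin_eq_antidiagonalTuple,
    Polynomial.finsetSum_coeff, partSum, Finset.sum_filter]
  refine Finset.sum_congr rfl fun n _ => ?_
  have h : (∏ i : Fin k, (C (v i) * X ^ ((i : ℕ) + 1)) ^ n i : R[X]) =
      C (∏ i : Fin k, v i ^ n i) * X ^ (∑ i : Fin k, ((i : ℕ) + 1) * n i) := by
    simp_rw [mul_pow, Finset.prod_mul_distrib, ← pow_mul, Finset.prod_pow_eq_pow_sum, map_prod,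
      map_pow]
  rw [h, ← Polynomial.C_eq_natCast, ← mul_assoc, ← C_mul, coeff_C_mul_X_pow]
  simp only [eq_comm]

theorem compSum_eq_coeff (k : ℕ) (v : ℕ → R) (r : ℕ) : ∀ m ≤ k,
    compSum v r m =
      ((∑ i : Fin k, C (v ((i : ℕ) + 1)) * X ^ ((i : ℕ) + 1)) ^ r : R[X]).coeff m := by
  induction r with
  | zero => intro m _; simp [compSum, coeff_one]
  | succ r ih =>
    intro m hm
    rw [compSum, pow_succ', Finset.sum_mul, finsetSum_coeff]
    simp_rw [mul_assoc, coeff_C_mul, coeff_X_pow_mul']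
    set p : R[X] := (∑ i : Fin k, C (v ((i : ℕ) + 1)) * X ^ ((i : ℕ) + 1)) ^ r
    rw [Fin.sum_univ_eq_sum_range
      (fun i => v (i + 1) * if i + 1 ≤ m then p.coeff (m - (i + 1)) else 0) k]
    refine Finset.sum_congr_of_eq_on_inter ?_ ?_ ?_
    · intro i hi hi'; simp at hi hi'; omega
    · intro i hi hi'
      have : ¬ (i + 1 ≤ m) := by simpa using hi'
      simp [this]
    · intro i hi hi'
      have : i + 1 ≤ m := by simpa using hi
      rw [if_pos this, ih _ (by omega)]

/-- A composition of `m` has no part exceeding `m ≤ k`, so the bound `k` on the parts is no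
restriction. This replaces the enumeration of exponent tuples by a recursion on the first part. -/
theorem partSum_eq_compSum {k m : ℕ} (hm : m ≤ k) (r : ℕ) (v : ℕ → R) :
    partSum k m r (fun i : Fin k => v ((i : ℕ) + 1)) = compSum v r m := by
  rw [partSum_eq_coeff, compSum_eq_coeff k v r m hm]

theorem compSum_succ (v : ℕ → R) (r m : ℕ) : compSum v (r + 1) m =
    ∑ i ∈ Finset.range m, v (i + 1) * compSum v r (m - (i + 1)) := rfl

theorem compSum_of_lt (v : ℕ → R) {r : ℕ} : ∀ {m : ℕ}, m < r → compSum v r m = 0 := by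
  induction r with
  | zero => intro m h; omega
  | succ r ih =>
    intro m h
    rw [compSum_succ]
    exact Finset.sum_eq_zero fun i hi => by
      rw [ih (by simp at hi; omega), mul_zero]

theorem compSum_one_left (v : ℕ → R) (m : ℕ) : compSum v 1 (m + 1) = v (m + 1) := by
  rw [compSum_succ, Finset.sum_range_succ, Finset.sum_eq_zero fun i hi => ?_]
  · simp [compSum]
  · simp at hi
    simp [compSum, show m - i ≠ 0 by omega]

theorem compSum_one (v : ℕ → R) :
    compSum v 1 1 = v 1 := compSum_one_left v 0

theorem compSum_two (v : ℕ → R) :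
    compSum v 1 2 = v 2 ∧
    compSum v 2 2 = v 1 ^ 2 := by
  refine ⟨compSum_one_left v 1, ?_⟩
  rw [compSum_succ]
  simp [Finset.sum_range_succ, compSum_of_lt, compSum_one]
  ring

theorem compSum_three (v : ℕ → R) :
    compSum v 1 3 = v 3 ∧
    compSum v 2 3 = 2 * v 1 * v 2 ∧
    compSum v 3 3 = v 1 ^ 3 := by
  refine ⟨compSum_one_left v 2, ?_, ?_⟩ <;>
  · rw [compSum_succ]
    simp [Finset.sum_range_succ, compSum_of_lt, compSum_one, compSum_two]
    ring

theorem compSum_four (v : ℕ → R) :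
    compSum v 1 4 = v 4 ∧
    compSum v 2 4 = v 2 ^ 2 + 2 * v 1 * v 3 ∧
    compSum v 3 4 = 3 * v 1 ^ 2 * v 2 ∧
    compSum v 4 4 = v 1 ^ 4 := by
  refine ⟨compSum_one_left v 3, ?_, ?_, ?_⟩ <;>
  · rw [compSum_succ]
    simp [Finset.sum_range_succ, compSum_of_lt, compSum_one, compSum_two, compSum_three]
    ring

theorem compSum_five (v : ℕ → R) :
    compSum v 1 5 = v 5 ∧
    compSum v 2 5 = 2 * v 2 * v 3 + 2 * v 1 * v 4 ∧
    compSum v 3 5 = 3 * v 1 * v 2 ^ 2 + 3 * v 1 ^ 2 * v 3 ∧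
    compSum v 4 5 = 4 * v 1 ^ 3 * v 2 ∧
    compSum v 5 5 = v 1 ^ 5 := by
  refine ⟨compSum_one_left v 4, ?_, ?_, ?_, ?_⟩ <;>
  · rw [compSum_succ]
    simp [Finset.sum_range_succ, compSum_of_lt, compSum_one, compSum_two, compSum_three,
      compSum_four]
    ring

theorem compSum_six (v : ℕ → R) :
    compSum v 1 6 = v 6 ∧
    compSum v 2 6 = v 3 ^ 2 + 2 * v 2 * v 4 + 2 * v 1 * v 5 ∧
    compSum v 3 6 = v 2 ^ 3 + 6 * v 1 * v 2 * v 3 + 3 * v 1 ^ 2 * v 4 ∧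
    compSum v 4 6 = 6 * v 1 ^ 2 * v 2 ^ 2 + 4 * v 1 ^ 3 * v 3 ∧
    compSum v 5 6 = 5 * v 1 ^ 4 * v 2 ∧
    compSum v 6 6 = v 1 ^ 6 := by
  refine ⟨compSum_one_left v 5, ?_, ?_, ?_, ?_, ?_⟩ <;>
  · rw [compSum_succ]
    simp [Finset.sum_range_succ, compSum_of_lt, compSum_one, compSum_two, compSum_three,
      compSum_four, compSum_five]
    ring

theorem compSum_seven (v : ℕ → R) :
    compSum v 1 7 = v 7 ∧
    compSum v 2 7 = 2 * v 3 * v 4 + 2 * v 2 * v 5 + 2 * v 1 * v 6 ∧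
    compSum v 3 7 = 3 * v 2 ^ 2 * v 3 + 3 * v 1 * v 3 ^ 2 + 6 * v 1 * v 2 * v 4 + 3 * v 1 ^ 2 * v 5
    ∧
    compSum v 4 7 = 4 * v 1 * v 2 ^ 3 + 12 * v 1 ^ 2 * v 2 * v 3 + 4 * v 1 ^ 3 * v 4 ∧
    compSum v 5 7 = 10 * v 1 ^ 3 * v 2 ^ 2 + 5 * v 1 ^ 4 * v 3 ∧
    compSum v 6 7 = 6 * v 1 ^ 5 * v 2 ∧
    compSum v 7 7 = v 1 ^ 7 := by
  refine ⟨compSum_one_left v 6, ?_, ?_, ?_, ?_, ?_, ?_⟩ <;>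
  · rw [compSum_succ]
    simp [Finset.sum_range_succ, compSum_of_lt, compSum_one, compSum_two, compSum_three,
      compSum_four, compSum_five, compSum_six]
    ring

end PartSum

/-! ### Values of `λ`, `b_j`, `a_{i,j}`, `c_i` for `tanh` and `arctan`. -/

section Evaluation

variable (τ : ℕ) (a : ℕ → ℚ)

theorem coeffB_eq {j : ℕ} (hj : j ≤ 6) :
    coeffB τ a j = lam τ a ^ (j + 1) * ∑ s ∈ Finset.range (j + 1),
      falling (-τ) (j + 1 - s) / (j + 1 - s).factorial * compSum a (j + 1 - s) (j + 1) := by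
  simp only [coeffB, partSum_eq_compSum (show j + 1 ≤ 7 by omega)]

/-- The sequence `1, b₁, b₂, …`, starting at the index `1`. -/
def shiftB (i : ℕ) : ℚ := if i = 1 then 1 else coeffB τ a (i - 1)

theorem coeffA_zero_eq {j : ℕ} (hj : j ≤ 7) :
    coeffA τ a 0 j = ∑ s ∈ Finset.range j,
      (-1) ^ (j - 1 - s) / ((j - s : ℕ) : ℚ) * compSum (shiftB τ a) (j - s) j := by
  have h : oneB τ a = fun i : Fin 7 => shiftB τ a ((i : ℕ) + 1) := by
    ext i; simp [oneB, shiftB]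
  simp only [coeffA, if_true, h, partSum_eq_compSum hj]

theorem coeffA_pos_eq {i j : ℕ} (hi : i ≠ 0) (hj : j - i ≤ 7) :
    coeffA τ a i j = ∑ s ∈ Finset.range (j - i),
      falling (-i) (j - i - s) / (j - i - s).factorial *
        compSum (shiftB τ a) (j - i - s) (j - i) := by
  have h : oneB τ a = fun i : Fin 7 => shiftB τ a ((i : ℕ) + 1) := by
    ext i; simp [oneB, shiftB]
  simp only [coeffA, if_neg hi, h, partSum_eq_compSum hj]

end Evaluation

theorem coeffC_succ (τ : ℕ) (a : ℕ → ℚ) (i : ℕ) :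
    coeffC τ a (i + 1) = (1 / ((i + 1 : ℕ) : ℚ)) * (coeffB τ a (i + 2) +
      ∑ h ∈ Finset.range (i + 1), coeffA τ a h (i + 2) * coeffC τ a h) := by
  rw [coeffC, Fin.sum_univ_eq_sum_range (fun h => coeffA τ a h (i + 2) * coeffC τ a h)]

theorem coeffC_zero (τ : ℕ) (a : ℕ → ℚ) : coeffC τ a 0 = -coeffB τ a 1 := by
  rw [coeffC]

theorem lam_tanhA : lam 2 tanhA = 3 / 2 := by norm_num [lam, tanhA]

theorem coeffB_tanhA :
    coeffB 2 tanhA 1 = 3 / 20 ∧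
    coeffB 2 tanhA 2 = -1 / 28 ∧
    coeffB 2 tanhA 3 = 3 / 400 ∧
    coeffB 2 tanhA 4 = -9 / 6160 ∧
    coeffB 2 tanhA 5 = 691 / 2548000 ∧
    coeffB 2 tanhA 6 = -3 / 61600 := by
  refine ⟨?_, ?_, ?_, ?_, ?_, ?_⟩ <;> rw [coeffB_eq _ _ (by norm_num), lam_tanhA] <;>
  norm_num [Finset.sum_range_succ, falling, Finset.prod_range_succ, Nat.factorial,
    compSum_one, compSum_two, compSum_three, compSum_four, compSum_five, compSum_six,
    compSum_seven, tanhA]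

theorem shiftB_tanhA :
    shiftB 2 tanhA 1 = 1 ∧
    shiftB 2 tanhA 2 = 3 / 20 ∧
    shiftB 2 tanhA 3 = -1 / 28 ∧
    shiftB 2 tanhA 4 = 3 / 400 ∧
    shiftB 2 tanhA 5 = -9 / 6160 ∧
    shiftB 2 tanhA 6 = 691 / 2548000 ∧
    shiftB 2 tanhA 7 = -3 / 61600 := by
  simp [shiftB, coeffB_tanhA]

theorem coeffA_zero_tanhA :
    coeffA 2 tanhA 0 1 = 1 ∧
    coeffA 2 tanhA 0 2 = -7 / 20 ∧
    coeffA 2 tanhA 0 3 = 31 / 210 ∧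
    coeffA 2 tanhA 0 4 = -381 / 5600 ∧
    coeffA 2 tanhA 0 5 = 73 / 2200 ∧
    coeffA 2 tanhA 0 6 = -1414477 / 84084000 := by
  refine ⟨?_, ?_, ?_, ?_, ?_, ?_⟩ <;> rw [coeffA_zero_eq _ _ (by norm_num)] <;>
  norm_num [Finset.sum_range_succ, compSum_one, compSum_two, compSum_three, compSum_four,
    compSum_five, compSum_six, shiftB_tanhA]

/-- Intermediate values: together with the `a_{0,j}`, these are the entries that the recursion for
`c₁, …, c₅` consumes. -/
theorem coeffA_pos_tanhA :
    coeffA 2 tanhA 1 3 = 17 / 20 ∧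
    coeffA 2 tanhA 1 4 = -93 / 140 ∧
    coeffA 2 tanhA 2 4 = 27 / 10 ∧
    coeffA 2 tanhA 1 5 = 691 / 1400 ∧
    coeffA 2 tanhA 2 5 = -106 / 35 ∧
    coeffA 2 tanhA 3 5 = 111 / 20 ∧
    coeffA 2 tanhA 1 6 = -5461 / 15400 ∧
    coeffA 2 tanhA 2 6 = 8507 / 2800 ∧
    coeffA 2 tanhA 3 6 = -1133 / 140 ∧
    coeffA 2 tanhA 4 6 = 47 / 5 := by
  refine ⟨?_, ?_, ?_, ?_, ?_, ?_, ?_, ?_, ?_, ?_⟩ <;>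
  rw [coeffA_pos_eq _ _ (by norm_num) (by norm_num)] <;>
  norm_num [Finset.sum_range_succ, falling, Finset.prod_range_succ, Nat.factorial,
    compSum_one, compSum_two, compSum_three, compSum_four, compSum_five, shiftB_tanhA]

theorem coeffC_tanhA_zero : coeffC 2 tanhA 0 = -3 / 20 := by
  norm_num [coeffC_zero, coeffB_tanhA]

theorem coeffC_tanhA_one : coeffC 2 tanhA 1 = 47 / 2800 := by
  norm_num [coeffC_succ 2 tanhA 0, Finset.sum_range_succ, coeffB_tanhA,
    coeffA_zero_tanhA, coeffA_pos_tanhA, coeffC_tanhA_zero]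

theorem coeffC_tanhA_two : coeffC 2 tanhA 2 = -3 / 16000 := by
  norm_num [coeffC_succ 2 tanhA 1, Finset.sum_range_succ, coeffB_tanhA,
    coeffA_zero_tanhA, coeffA_pos_tanhA, coeffC_tanhA_zero, coeffC_tanhA_one]

theorem coeffC_tanhA_three : coeffC 2 tanhA 3 = -83723 / 86240000 := by
  norm_num [coeffC_succ 2 tanhA 2, Finset.sum_range_succ, coeffB_tanhA,
    coeffA_zero_tanhA, coeffA_pos_tanhA, coeffC_tanhA_zero, coeffC_tanhA_one, coeffC_tanhA_two]

theorem coeffC_tanhA_four : coeffC 2 tanhA 4 = -27832729 / 89689600000 := by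
  norm_num [coeffC_succ 2 tanhA 3, Finset.sum_range_succ, coeffB_tanhA,
    coeffA_zero_tanhA, coeffA_pos_tanhA, coeffC_tanhA_zero, coeffC_tanhA_one, coeffC_tanhA_two,
    coeffC_tanhA_three]

theorem coeffC_tanhA_five : coeffC 2 tanhA 5 = 2800730629 / 15695680000000 := by
  norm_num [coeffC_succ 2 tanhA 4, Finset.sum_range_succ, coeffB_tanhA,
    coeffA_zero_tanhA, coeffA_pos_tanhA, coeffC_tanhA_zero, coeffC_tanhA_one, coeffC_tanhA_two,
    coeffC_tanhA_three, coeffC_tanhA_four]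

theorem lam_arctanA : lam 2 arctanA = 3 / 2 := by norm_num [lam, arctanA]

theorem coeffB_arctanA :
    coeffB 2 arctanA 1 = -3 / 20 ∧
    coeffB 2 arctanA 2 = 4 / 35 ∧
    coeffB 2 arctanA 3 = -19 / 175 ∧
    coeffB 2 arctanA 4 = 222 / 1925 ∧
    coeffB 2 arctanA 5 = -459257 / 3503500 ∧
    coeffB 2 arctanA 6 = 109271 / 700700 := by
  refine ⟨?_, ?_, ?_, ?_, ?_, ?_⟩ <;> rw [coeffB_eq _ _ (by norm_num), lam_arctanA] <;>
  norm_num [Finset.sum_range_succ, falling, Finset.prod_range_succ, Nat.factorial,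
    compSum_one, compSum_two, compSum_three, compSum_four, compSum_five, compSum_six,
    compSum_seven, arctanA]

theorem shiftB_arctanA :
    shiftB 2 arctanA 1 = 1 ∧
    shiftB 2 arctanA 2 = -3 / 20 ∧
    shiftB 2 arctanA 3 = 4 / 35 ∧
    shiftB 2 arctanA 4 = -19 / 175 ∧
    shiftB 2 arctanA 5 = 222 / 1925 ∧
    shiftB 2 arctanA 6 = -459257 / 3503500 ∧
    shiftB 2 arctanA 7 = 109271 / 700700 := by
  simp [shiftB, coeffB_arctanA]

theorem coeffA_zero_arctanA :
    coeffA 2 arctanA 0 1 = 1 ∧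
    coeffA 2 arctanA 0 2 = -13 / 20 ∧
    coeffA 2 arctanA 0 3 = 251 / 420 ∧
    coeffA 2 arctanA 0 4 = -3551 / 5600 ∧
    coeffA 2 arctanA 0 5 = 22417 / 30800 ∧
    coeffA 2 arctanA 0 6 = -147636491 / 168168000 := by
  refine ⟨?_, ?_, ?_, ?_, ?_, ?_⟩ <;> rw [coeffA_zero_eq _ _ (by norm_num)] <;>
  norm_num [Finset.sum_range_succ, compSum_one, compSum_two, compSum_three, compSum_four,
    compSum_five, compSum_six, shiftB_arctanA]

theorem coeffA_pos_arctanA :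
    coeffA 2 arctanA 1 3 = 23 / 20 ∧
    coeffA 2 arctanA 1 4 = -99 / 70 ∧
    coeffA 2 arctanA 2 4 = 33 / 10 ∧
    coeffA 2 arctanA 1 5 = 5067 / 2800 ∧
    coeffA 2 arctanA 2 5 = -359 / 70 ∧
    coeffA 2 arctanA 3 5 = 129 / 20 ∧
    coeffA 2 arctanA 1 6 = -14643 / 6160 ∧
    coeffA 2 arctanA 2 6 = 21757 / 2800 ∧
    coeffA 2 arctanA 3 6 = -85 / 7 ∧
    coeffA 2 arctanA 4 6 = 53 / 5 := by
  refine ⟨?_, ?_, ?_, ?_, ?_, ?_, ?_, ?_, ?_, ?_⟩ <;>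
  rw [coeffA_pos_eq _ _ (by norm_num) (by norm_num)] <;>
  norm_num [Finset.sum_range_succ, falling, Finset.prod_range_succ, Nat.factorial,
    compSum_one, compSum_two, compSum_three, compSum_four, compSum_five, shiftB_arctanA]

theorem coeffC_arctanA_zero : coeffC 2 arctanA 0 = 3 / 20 := by
  norm_num [coeffC_zero, coeffB_arctanA]

theorem coeffC_arctanA_one : coeffC 2 arctanA 1 = 47 / 2800 := by
  norm_num [coeffC_succ 2 arctanA 0, Finset.sum_range_succ, coeffB_arctanA,
    coeffA_zero_arctanA, coeffA_pos_arctanA, coeffC_arctanA_zero]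

theorem coeffC_arctanA_two : coeffC 2 arctanA 2 = 3 / 16000 := by
  norm_num [coeffC_succ 2 arctanA 1, Finset.sum_range_succ, coeffB_arctanA,
    coeffA_zero_arctanA, coeffA_pos_arctanA, coeffC_arctanA_zero, coeffC_arctanA_one]

theorem coeffC_arctanA_three : coeffC 2 arctanA 3 = -83723 / 86240000 := by
  norm_num [coeffC_succ 2 arctanA 2, Finset.sum_range_succ, coeffB_arctanA,
    coeffA_zero_arctanA, coeffA_pos_arctanA, coeffC_arctanA_zero, coeffC_arctanA_one,
    coeffC_arctanA_two]

theorem coeffC_arctanA_four : coeffC 2 arctanA 4 = 27832729 / 89689600000 := by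
  norm_num [coeffC_succ 2 arctanA 3, Finset.sum_range_succ, coeffB_arctanA,
    coeffA_zero_arctanA, coeffA_pos_arctanA, coeffC_arctanA_zero, coeffC_arctanA_one,
    coeffC_arctanA_two, coeffC_arctanA_three]

theorem coeffC_arctanA_five : coeffC 2 arctanA 5 = 2800730629 / 15695680000000 := by
  norm_num [coeffC_succ 2 arctanA 4, Finset.sum_range_succ, coeffB_arctanA,
    coeffA_zero_arctanA, coeffA_pos_arctanA, coeffC_arctanA_zero, coeffC_arctanA_one,
    coeffC_arctanA_two, coeffC_arctanA_three, coeffC_arctanA_four]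

/-! ### The polynomials `T_m` and `P_m` for both functions, and the sign symmetry. -/

section Polynomials

variable (τ : ℕ) (a : ℕ → ℚ)

theorem polyT_one : polyT τ a 1 = X := by rw [polyT]

theorem polyT_succ (m : ℕ) : polyT τ a (m + 2) =
    C (coeffB τ a 1) * ∑ s ∈ Finset.range (m + 1),
        C ((-1) ^ (m - s) / ((m + 1 - s : ℕ) : ℚ)) * compSum (polyT τ a) (m + 1 - s) (m + 1)
      - C (coeffC τ a (m + 1))
      - ∑ p ∈ Finset.Icc 1 m, C (coeffC τ a p) *
          ∑ q ∈ Finset.Icc 1 (m + 1 - p), C (falling (-p) q / q.factorial) *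
            compSum (polyT τ a) q (m + 1 - p) := by
  rw [polyT]
  simp only [partSum_eq_compSum (Nat.sub_le _ _), partSum_eq_compSum le_rfl]

theorem polyP_one : polyP τ a 1 = X := by simp [polyP]

theorem polyP_eq {m : ℕ} (hm : 2 ≤ m) (hm' : m ≤ 6) : polyP τ a m =
    ∑ s ∈ Finset.range m, C (falling (-1 / τ) (m - s) / (m - s).factorial) *
      compSum (polyTt τ a) (m - s) m := by
  simp only [polyP, if_neg (show m ≠ 0 by omega), if_neg (show m ≠ 1 by omega),
    partSum_eq_compSum hm']

end Polynomials

theorem polyT_tanhA_two : polyT 2 tanhA 2 =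
    C (3 / 20) * X - C (47 / 2800) := by
  -- Over the infinite field `ℚ` polynomials may be compared by their values, which leaves an
  -- identity of rational expressions in `x`.
  refine Polynomial.funext fun x => ?_
  simp [polyT_succ 2 tanhA 0, compSum_one,
    coeffB_tanhA, coeffC_tanhA_one,
    polyT_one]

theorem polyT_tanhA_three : polyT 2 tanhA 3 =
    -C (3 / 40) * X ^ 2 + C (11 / 280) * X - C (261 / 112000) := by
  refine Polynomial.funext fun x => ?_
  simp [polyT_succ 2 tanhA 1, Finset.sum_range_succ, falling, Nat.factorial, compSum_one,
    compSum_two,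
    coeffB_tanhA, coeffC_tanhA_one, coeffC_tanhA_two,
    polyT_one, polyT_tanhA_two]
  ring

theorem polyT_tanhA_four : polyT 2 tanhA 4 =
    C (1 / 20) * X ^ 3 - C (283 / 5600) * X ^ 2 + C (591 / 56000) * X + C (58557 / 172480000) := by
  refine Polynomial.funext fun x => ?_
  simp [polyT_succ 2 tanhA 2, Finset.sum_range_succ, Finset.sum_Icc_succ_top, falling,
    Finset.prod_range_succ, Nat.factorial, compSum_one, compSum_two, compSum_three,
    coeffB_tanhA, coeffC_tanhA_one, coeffC_tanhA_two, coeffC_tanhA_three,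
    polyT_one, polyT_tanhA_two, polyT_tanhA_three]
  ring

theorem polyP_tanhA_two : polyP 2 tanhA 2 =
    C (3 / 2) * X ^ 2 + C (3 / 20) * X + C (47 / 5600) := by
  refine Polynomial.funext fun x => ?_
  simp [polyP_eq 2 tanhA (m := 2) (by norm_num) (by norm_num), Finset.sum_range_succ, falling,
    Finset.prod_range_succ, compSum_two, polyTt,
    polyT_one, polyT_tanhA_two]
  ring

theorem polyP_tanhA_three : polyP 2 tanhA 3 =
    C (5 / 2) * X ^ 3 + C (3 / 5) * X ^ 2 + C (361 / 5600) * X + C (261 / 224000) := by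
  refine Polynomial.funext fun x => ?_
  simp [polyP_eq 2 tanhA (m := 3) (by norm_num) (by norm_num), Finset.sum_range_succ, falling,
    Finset.prod_range_succ, Nat.factorial, compSum_three, polyTt,
    polyT_one, polyT_tanhA_two, polyT_tanhA_three]
  ring

theorem polyP_tanhA_four : polyP 2 tanhA 4 =
    C (35 / 8) * X ^ 4 + C (71 / 40) * X ^ 3 + C (101 / 320) * X ^ 2 + C (3993 / 224000) * X - C
      (44217 / 689920000) := by
  refine Polynomial.funext fun x => ?_
  simp [polyP_eq 2 tanhA (m := 4) (by norm_num) (by norm_num), Finset.sum_range_succ, falling,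
    Finset.prod_range_succ, Nat.factorial, compSum_four, polyTt,
    polyT_one, polyT_tanhA_two, polyT_tanhA_three, polyT_tanhA_four]
  ring

theorem polyT_arctanA_two : polyT 2 arctanA 2 =
    -C (3 / 20) * X - C (47 / 2800) := by
  refine Polynomial.funext fun x => ?_
  simp [polyT_succ 2 arctanA 0, compSum_one,
    coeffB_arctanA, coeffC_arctanA_one,
    polyT_one]
  ring

theorem polyT_arctanA_three : polyT 2 arctanA 3 =
    C (3 / 40) * X ^ 2 + C (11 / 280) * X + C (261 / 112000) := by
  refine Polynomial.funext fun x => ?_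
  simp [polyT_succ 2 arctanA 1, Finset.sum_range_succ, falling, Nat.factorial, compSum_one,
    compSum_two,
    coeffB_arctanA, coeffC_arctanA_one, coeffC_arctanA_two,
    polyT_one, polyT_arctanA_two]
  ring

theorem polyT_arctanA_four : polyT 2 arctanA 4 =
    -C (1 / 20) * X ^ 3 - C (283 / 5600) * X ^ 2 - C (591 / 56000) * X + C (58557 / 172480000) := by
  refine Polynomial.funext fun x => ?_
  simp [polyT_succ 2 arctanA 2, Finset.sum_range_succ, Finset.sum_Icc_succ_top, falling,
    Finset.prod_range_succ, Nat.factorial, compSum_one, compSum_two, compSum_three,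
    coeffB_arctanA, coeffC_arctanA_one, coeffC_arctanA_two, coeffC_arctanA_three,
    polyT_one, polyT_arctanA_two, polyT_arctanA_three]
  ring

theorem polyP_arctanA_two : polyP 2 arctanA 2 =
    C (3 / 2) * X ^ 2 - C (3 / 20) * X + C (47 / 5600) := by
  refine Polynomial.funext fun x => ?_
  simp [polyP_eq 2 arctanA (m := 2) (by norm_num) (by norm_num), Finset.sum_range_succ, falling,
    Finset.prod_range_succ, compSum_two, polyTt,
    polyT_one, polyT_arctanA_two]
  ring

theorem polyP_arctanA_three : polyP 2 arctanA 3 =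
    C (5 / 2) * X ^ 3 - C (3 / 5) * X ^ 2 + C (361 / 5600) * X - C (261 / 224000) := by
  refine Polynomial.funext fun x => ?_
  simp [polyP_eq 2 arctanA (m := 3) (by norm_num) (by norm_num), Finset.sum_range_succ, falling,
    Finset.prod_range_succ, Nat.factorial, compSum_three, polyTt,
    polyT_one, polyT_arctanA_two, polyT_arctanA_three]
  ring

theorem polyP_arctanA_four : polyP 2 arctanA 4 =
    C (35 / 8) * X ^ 4 - C (71 / 40) * X ^ 3 + C (101 / 320) * X ^ 2 - C (3993 / 224000) * X - C
      (44217 / 689920000) := by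
  refine Polynomial.funext fun x => ?_
  simp [polyP_eq 2 arctanA (m := 4) (by norm_num) (by norm_num), Finset.sum_range_succ, falling,
    Finset.prod_range_succ, Nat.factorial, compSum_four, polyTt,
    polyT_one, polyT_arctanA_two, polyT_arctanA_three, polyT_arctanA_four]
  ring

/-- The computed values are compared. The formal reason for the symmetry: `tanh (i x) = i tan x`,
and `x ↦ i x` is `y ↦ -y`, so if `A` solves Abel's equation for `tanh` then `-A (-y)` solves it for
`arctan`, the inverse of `tan`, up to an additive constant. This sends `b₁` to `-b₁` and `c_i` to
`(-1) ^ (i + 1) c_i`. -/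
theorem coeffC_tanhA_eq : ∀ i ∈ Finset.Icc 1 5,
    coeffC 2 tanhA i = (-1) ^ (i + 1) * coeffC 2 arctanA i := by
  intro i hi
  simp only [Finset.mem_Icc] at hi
  obtain ⟨h1, h2⟩ := hi
  interval_cases i <;>
  norm_num [coeffC_tanhA_one, coeffC_tanhA_two, coeffC_tanhA_three, coeffC_tanhA_four,
    coeffC_tanhA_five, coeffC_arctanA_one, coeffC_arctanA_two, coeffC_arctanA_three,
    coeffC_arctanA_four, coeffC_arctanA_five]

theorem polyT_tanhA_coeff : ∀ m ∈ Finset.Icc 1 4, ∀ k : ℕ, (polyT 2 tanhA m).coeff k =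
    (-1) ^ (m + k) * (polyT 2 arctanA m).coeff k := by
  intro m hm k
  simp only [Finset.mem_Icc] at hm
  obtain ⟨h1, h2⟩ := hm
  -- All degrees are at most `4`, so the last case compares zeros.
  interval_cases m <;> rcases k with _ | _ | _ | _ | _ | k <;>
  norm_num [polyT_one, polyT_tanhA_two, polyT_tanhA_three, polyT_tanhA_four,
    polyT_arctanA_two, polyT_arctanA_three, polyT_arctanA_four,
    coeff_X, coeff_C, coeff_X_pow]

theorem polyP_tanhA_coeff : ∀ m ∈ Finset.Icc 1 4, ∀ k : ℕ, (polyP 2 tanhA m).coeff k =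
    (-1) ^ (m + k) * (polyP 2 arctanA m).coeff k := by
  intro m hm k
  simp only [Finset.mem_Icc] at hm
  obtain ⟨h1, h2⟩ := hm
  interval_cases m <;> rcases k with _ | _ | _ | _ | _ | k <;>
  norm_num [polyP_one, polyP_tanhA_two, polyP_tanhA_three, polyP_tanhA_four,
    polyP_arctanA_two, polyP_arctanA_three, polyP_arctanA_four,
    coeff_X, coeff_C, coeff_X_pow]

theorem tanhCoeff_eq (K : ℝ) (m j : ℕ) :
    tanhCoeff K m j = (-1) ^ m * arctanCoeff K m j := by
  rcases m with _ | _ | _ | _ | _ | m <;> rcases j with _ | _ | _ | _ | _ | j <;>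
  simp [tanhCoeff, arctanCoeff] <;> ring

/-! ### Orders of magnitude up to arbitrarily small powers, which absorb logarithms. -/

section Order

variable {α : Type*} {l : Filter α} {h : α → ℝ}

/-- `f = O(h ^ (k - δ))` for every `δ > 0`. -/
def Ord (l : Filter α) (h : α → ℝ) (k : ℝ) (f : α → ℝ) : Prop :=
  ∀ δ > 0, f =O[l] fun t => h t ^ (k - δ)

theorem isBigO_rpow_of_le (hh : Tendsto h l (𝓝[>] 0)) {k m : ℝ} (hkm : k ≤ m) :
    (fun t => h t ^ m) =O[l] fun t => h t ^ k := by
  refine IsBigO.of_bound 1 ?_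
  have h0 : ∀ᶠ t in l, 0 < h t := hh.eventually self_mem_nhdsWithin
  have h1 : ∀ᶠ t in l, h t < 1 :=
    hh.eventually (nhdsWithin_le_nhds (Iio_mem_nhds one_pos))
  filter_upwards [h0, h1] with t h0 h1
  rw [one_mul, Real.norm_of_nonneg (by positivity), Real.norm_of_nonneg (by positivity)]
  exact Real.rpow_le_rpow_of_exponent_ge h0 h1.le hkm

theorem isLittleO_rpow_of_lt (hh : Tendsto h l (𝓝[>] 0)) {k m : ℝ} (hkm : k < m) :
    (fun t => h t ^ m) =o[l] fun t => h t ^ k := by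
  have h0 : ∀ᶠ t in l, 0 < h t := hh.eventually self_mem_nhdsWithin
  have h1 : Tendsto (fun t => h t ^ (m - k)) l (𝓝 0) := by
    have := (Real.continuousAt_rpow_const 0 (m - k) (Or.inr (by linarith))).tendsto.comp
      (hh.mono_right nhdsWithin_le_nhds)
    rwa [Real.zero_rpow (by linarith)] at this
  have h2 := ((isLittleO_one_iff ℝ).2 h1).mul_isBigO (isBigO_refl (fun t => h t ^ k) l)
  refine (h2.congr' ?_ ?_)
  · filter_upwards [h0] with t ht
    rw [← Real.rpow_add ht, sub_add_cancel]
  · exact Eventually.of_forall fun t => one_mul _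

namespace Ord

variable {k m : ℝ} {f g : α → ℝ}

theorem of_isBigO (hh : Tendsto h l (𝓝[>] 0)) (hf : f =O[l] fun t => h t ^ k) :
    Ord l h k f := fun δ hδ =>
  hf.trans (isBigO_rpow_of_le hh (by linarith))

theorem isLittleO (hh : Tendsto h l (𝓝[>] 0)) (hf : Ord l h k f) (hmk : m < k) :
    f =o[l] fun t => h t ^ m :=
  (hf ((k - m) / 2) (by linarith)).trans_isLittleO (isLittleO_rpow_of_lt hh (by linarith))

theorem tendsto_zero (hh : Tendsto h l (𝓝[>] 0)) (hf : Ord l h k f) (hk : 0 < k) :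
    Tendsto f l (𝓝 0) := by
  have := hf.isLittleO hh hk
  simp only [Real.rpow_zero] at this
  exact (isLittleO_one_iff ℝ).1 this

theorem mono (hh : Tendsto h l (𝓝[>] 0)) (hf : Ord l h k f) (hmk : m ≤ k) : Ord l h m f :=
  fun δ hδ => (hf δ hδ).trans (isBigO_rpow_of_le hh (by linarith))

theorem of_le {g : α → ℝ} (hg : Ord l h k g) (hfg : f =O[l] g) : Ord l h k f :=
  fun δ hδ => hfg.trans (hg δ hδ)

theorem congr' (hf : Ord l h k f) (hfg : f =ᶠ[l] g) : Ord l h k g :=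
  fun δ hδ => (hf δ hδ).congr' hfg EventuallyEq.rfl

theorem add (hf : Ord l h k f) (hg : Ord l h k g) : Ord l h k fun t => f t + g t :=
  fun δ hδ => (hf δ hδ).add (hg δ hδ)

theorem sub (hf : Ord l h k f) (hg : Ord l h k g) : Ord l h k fun t => f t - g t :=
  fun δ hδ => (hf δ hδ).sub (hg δ hδ)

theorem mul (hh : Tendsto h l (𝓝[>] 0)) (hf : Ord l h k f) (hg : Ord l h m g) :
    Ord l h (k + m) fun t => f t * g t := fun δ hδ => by
  refine ((hf (δ / 2) (by linarith)).mul (hg (δ / 2) (by linarith))).congr'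
    EventuallyEq.rfl ?_
  filter_upwards [hh.eventually self_mem_nhdsWithin] with t ht
  rw [← Real.rpow_add ht]
  congr 1
  ring

theorem const (hh : Tendsto h l (𝓝[>] 0)) (c : ℝ) : Ord l h 0 fun _ => c :=
  of_isBigO hh (by simpa using isBigO_const_const c (one_ne_zero (α := ℝ)) l)

theorem scale_pow (hh : Tendsto h l (𝓝[>] 0)) (n : ℕ) : Ord l h n fun t => h t ^ n :=
  of_isBigO hh (by simpa using isBigO_refl _ l)

theorem pow (hh : Tendsto h l (𝓝[>] 0)) (hf : Ord l h k f) (n : ℕ) :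
    Ord l h (n * k) fun t => f t ^ n := by
  induction n with
  | zero => simpa using const hh 1
  | succ n ih =>
    have := ih.mul hh hf
    simp only [pow_succ]
    convert this using 1
    push_cast
    ring

end Ord

/-! ### Truncated power series -/

/-- The coefficients of a power series up to the fifth power. -/
@[ext]
structure Jet where
  /-- the constant coefficient -/
  c0 : ℝ
  /-- the coefficient of the first power -/
  c1 : ℝ
  /-- the coefficient of the second power -/
  c2 : ℝ
  /-- the coefficient of the third power -/
  c3 : ℝ
  /-- the coefficient of the fourth power -/
  c4 : ℝ
  /-- the coefficient of the fifth power -/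
  c5 : ℝ

namespace Jet

/-- The polynomial with the given coefficients. -/
def eval (a : Jet) (x : ℝ) : ℝ :=
  a.c0 + a.c1 * x + a.c2 * x ^ 2 + a.c3 * x ^ 3 + a.c4 * x ^ 4 + a.c5 * x ^ 5

/-- The coefficientwise sum. -/
@[simps]
def add (a b : Jet) : Jet :=
  ⟨a.c0 + b.c0, a.c1 + b.c1, a.c2 + b.c2, a.c3 + b.c3, a.c4 + b.c4, a.c5 + b.c5⟩

/-- The truncated product. -/
@[simps]
def mul (a b : Jet) : Jet where
  c0 := a.c0 * b.c0
  c1 := a.c0 * b.c1 + a.c1 * b.c0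
  c2 := a.c0 * b.c2 + a.c1 * b.c1 + a.c2 * b.c0
  c3 := a.c0 * b.c3 + a.c1 * b.c2 + a.c2 * b.c1 + a.c3 * b.c0
  c4 := a.c0 * b.c4 + a.c1 * b.c3 + a.c2 * b.c2 + a.c3 * b.c1 + a.c4 * b.c0
  c5 := a.c0 * b.c5 + a.c1 * b.c4 + a.c2 * b.c3 + a.c3 * b.c2 + a.c4 * b.c1 + a.c5 * b.c0

/-- The constant series. -/
@[simps]
def const (c : ℝ) : Jet := ⟨c, 0, 0, 0, 0, 0⟩

/-- The variable. -/
@[simps]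
def var : Jet := ⟨0, 1, 0, 0, 0, 0⟩

/-- The logarithm of a series with constant coefficient `1`. -/
@[simps]
noncomputable def log (a : Jet) : Jet where
  c0 := 0
  c1 := a.c1
  c2 := a.c2 - a.c1 ^ 2 / 2
  c3 := a.c3 - a.c1 * a.c2 + a.c1 ^ 3 / 3
  c4 := a.c4 - a.c1 * a.c3 - a.c2 ^ 2 / 2 + a.c1 ^ 2 * a.c2 - a.c1 ^ 4 / 4
  c5 := a.c5 - a.c1 * a.c4 - a.c2 * a.c3 + a.c1 ^ 2 * a.c3 + a.c1 * a.c2 ^ 2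
    - a.c1 ^ 3 * a.c2 + a.c1 ^ 5 / 5

end Jet

/-- `f = a₀ + a₁ h + ⋯ + a₅ h⁵ + O(h ^ (6 - δ))` for every `δ > 0`, with coefficients that are
`O(h ^ (-δ))` for every `δ > 0`. -/
structure HasJet (l : Filter α) (h : α → ℝ) (f : α → ℝ) (a : α → Jet) : Prop where
  ord0 : Ord l h 0 fun t => (a t).c0
  ord1 : Ord l h 0 fun t => (a t).c1
  ord2 : Ord l h 0 fun t => (a t).c2
  ord3 : Ord l h 0 fun t => (a t).c3
  ord4 : Ord l h 0 fun t => (a t).c4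
  ord5 : Ord l h 0 fun t => (a t).c5
  rem : Ord l h 6 fun t => f t - (a t).eval (h t)

namespace HasJet

variable {f g : α → ℝ} {a b : α → Jet}

theorem mul_zero_ord (hh : Tendsto h l (𝓝[>] 0)) (hf : Ord l h 0 f) (hg : Ord l h 0 g) :
    Ord l h 0 fun t => f t * g t := by
  simpa using hf.mul hh hg

theorem mul_scale_pow (hh : Tendsto h l (𝓝[>] 0)) (hf : Ord l h 0 f) (n : ℕ) :
    Ord l h n fun t => f t * h t ^ n := by
  simpa using hf.mul hh (Ord.scale_pow hh n)

theorem eval_ord (hh : Tendsto h l (𝓝[>] 0)) (hf : HasJet l h f a) :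
    Ord l h 0 fun t => (a t).eval (h t) := by
  have key : ∀ (c : α → ℝ), Ord l h 0 c → ∀ n : ℕ, Ord l h 0 fun t => c t * h t ^ n :=
    fun c hc n => (mul_scale_pow hh hc n).mono hh (Nat.cast_nonneg n)
  have k1 := key _ hf.ord1 1
  simp only [pow_one] at k1
  exact ((((hf.ord0.add k1).add (key _ hf.ord2 2)).add (key _ hf.ord3 3)).add
    (key _ hf.ord4 4)).add (key _ hf.ord5 5)

theorem ord (hh : Tendsto h l (𝓝[>] 0)) (hf : HasJet l h f a) : Ord l h 0 f := by
  have := (hf.rem.mono hh (m := 0) (by norm_num)).add (hf.eval_ord hh)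
  simpa using this

theorem const (hh : Tendsto h l (𝓝[>] 0)) (hf : Ord l h 0 f) :
    HasJet l h f fun t => Jet.const (f t) where
  ord0 := hf
  ord1 := Ord.const hh 0
  ord2 := Ord.const hh 0
  ord3 := Ord.const hh 0
  ord4 := Ord.const hh 0
  ord5 := Ord.const hh 0
  rem := by
    refine Ord.of_isBigO hh ?_
    simpa [Jet.eval] using isBigO_zero _ l

theorem var (hh : Tendsto h l (𝓝[>] 0)) : HasJet l h h fun _ => Jet.var where
  ord0 := Ord.const hh 0
  ord1 := Ord.const hh 1
  ord2 := Ord.const hh 0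
  ord3 := Ord.const hh 0
  ord4 := Ord.const hh 0
  ord5 := Ord.const hh 0
  rem := by
    refine Ord.of_isBigO hh ?_
    simpa [Jet.eval] using isBigO_zero _ l

theorem add (hf : HasJet l h f a) (hg : HasJet l h g b) :
    HasJet l h (fun t => f t + g t) fun t => (a t).add (b t) where
  ord0 := hf.ord0.add hg.ord0
  ord1 := hf.ord1.add hg.ord1
  ord2 := hf.ord2.add hg.ord2
  ord3 := hf.ord3.add hg.ord3
  ord4 := hf.ord4.add hg.ord4
  ord5 := hf.ord5.add hg.ord5
  rem := by
    refine (hf.rem.add hg.rem).congr' (Eventually.of_forall fun t => ?_)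
    simp only [Jet.eval, Jet.add]
    ring

theorem mul (hh : Tendsto h l (𝓝[>] 0)) (hf : HasJet l h f a) (hg : HasJet l h g b) :
    HasJet l h (fun t => f t * g t) fun t => (a t).mul (b t) := by
  have M : ∀ {f g : α → ℝ}, Ord l h 0 f → Ord l h 0 g → Ord l h 0 fun t => f t * g t :=
    mul_zero_ord hh
  have P : ∀ {c : α → ℝ} (n : ℕ), Ord l h 0 c → Ord l h 0 fun t => c t * h t ^ n :=
    fun n hc => (mul_scale_pow hh hc n).mono hh (Nat.cast_nonneg n)
  refine ⟨M hf.ord0 hg.ord0, (M hf.ord0 hg.ord1).add (M hf.ord1 hg.ord0),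
    ((M hf.ord0 hg.ord2).add (M hf.ord1 hg.ord1)).add (M hf.ord2 hg.ord0),
    (((M hf.ord0 hg.ord3).add (M hf.ord1 hg.ord2)).add (M hf.ord2 hg.ord1)).add
      (M hf.ord3 hg.ord0),
    ((((M hf.ord0 hg.ord4).add (M hf.ord1 hg.ord3)).add (M hf.ord2 hg.ord2)).add
      (M hf.ord3 hg.ord1)).add (M hf.ord4 hg.ord0),
    (((((M hf.ord0 hg.ord5).add (M hf.ord1 hg.ord4)).add (M hf.ord2 hg.ord3)).add
      (M hf.ord3 hg.ord2)).add (M hf.ord4 hg.ord1)).add (M hf.ord5 hg.ord0), ?_⟩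
  -- With `A`, `B` the two polynomials, `f g - A B = f (g - B) + B (f - A)`; the terms `t6` to `t10`
  -- below are the part of `A B` of degree `6` to `10` that the truncated product drops.
  have r1 : Ord l h 6 fun t => f t * (g t - (b t).eval (h t)) := by
    simpa using (hf.ord hh).mul hh hg.rem
  have r2 : Ord l h 6 fun t => (b t).eval (h t) * (f t - (a t).eval (h t)) := by
    simpa using (hg.eval_ord hh).mul hh hf.rem
  have t6 := ((((M hf.ord1 hg.ord5).add (M hf.ord2 hg.ord4)).add (M hf.ord3 hg.ord3)).add
      (M hf.ord4 hg.ord2)).add (M hf.ord5 hg.ord1)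
  have t7 := P 1 ((((M hf.ord2 hg.ord5).add (M hf.ord3 hg.ord4)).add (M hf.ord4 hg.ord3)).add
      (M hf.ord5 hg.ord2))
  have t8 := P 2 (((M hf.ord3 hg.ord5).add (M hf.ord4 hg.ord4)).add (M hf.ord5 hg.ord3))
  have t9 := P 3 ((M hf.ord4 hg.ord5).add (M hf.ord5 hg.ord4))
  have t10 := P 4 (M hf.ord5 hg.ord5)
  have r3 := mul_scale_pow hh ((((t6.add t7).add t8).add t9).add t10) 6
  refine ((r1.add r2).add r3).congr' (Eventually.of_forall fun t => ?_)
  simp only [Jet.eval, Jet.mul]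
  ring

theorem congr (hf : HasJet l h f a) (hfg : f =ᶠ[l] g) (hab : ∀ t, a t = b t) :
    HasJet l h g b := by
  obtain rfl : a = b := funext hab
  refine ⟨hf.ord0, hf.ord1, hf.ord2, hf.ord3, hf.ord4, hf.ord5, hf.rem.congr' ?_⟩
  filter_upwards [hfg] with t ht
  rw [ht]

theorem add_ord (hf : HasJet l h f a) (hg : Ord l h 6 g) :
    HasJet l h (fun t => f t + g t) a := by
  refine ⟨hf.ord0, hf.ord1, hf.ord2, hf.ord3, hf.ord4, hf.ord5,
    (hf.rem.add hg).congr' (Eventually.of_forall fun t => ?_)⟩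
  ring

theorem ord_five (hh : Tendsto h l (𝓝[>] 0)) (hf : HasJet l h f a)
    (h0 : ∀ t, (a t).c0 = 0) (h1 : ∀ t, (a t).c1 = 0) (h2 : ∀ t, (a t).c2 = 0)
    (h3 : ∀ t, (a t).c3 = 0) (h4 : ∀ t, (a t).c4 = 0) : Ord l h 5 f := by
  have := (hf.rem.mono hh (m := (5 : ℕ)) (by norm_num)).add (mul_scale_pow hh hf.ord5 5)
  simp only [Jet.eval, h0, h1, h2, h3, h4] at this
  simpa using this

theorem ord_six (hf : HasJet l h f a)
    (h0 : ∀ t, (a t).c0 = 0) (h1 : ∀ t, (a t).c1 = 0) (h2 : ∀ t, (a t).c2 = 0)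
    (h3 : ∀ t, (a t).c3 = 0) (h4 : ∀ t, (a t).c4 = 0) (h5 : ∀ t, (a t).c5 = 0) :
    Ord l h 6 f := by
  simpa [Jet.eval, h0, h1, h2, h3, h4, h5] using hf.rem

theorem ord_one (hh : Tendsto h l (𝓝[>] 0)) (hf : HasJet l h f a)
    (h0 : ∀ t, (a t).c0 = 0) : Ord l h 1 f := by
  have P : ∀ {c : α → ℝ} (n : ℕ), 1 ≤ n → Ord l h 0 c → Ord l h 1 fun t => c t * h t ^ n :=
    fun n hn hc => (mul_scale_pow hh hc n).mono hh (by exact_mod_cast hn)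
  refine ((((((P 1 le_rfl hf.ord1).add (P 2 (by norm_num) hf.ord2)).add
    (P 3 (by norm_num) hf.ord3)).add (P 4 (by norm_num) hf.ord4)).add
    (P 5 (by norm_num) hf.ord5)).add (hf.rem.mono hh (by norm_num))).congr'
    (Eventually.of_forall fun t => ?_)
  simp only [Jet.eval, h0]
  ring

theorem sub_one_ord (hh : Tendsto h l (𝓝[>] 0)) (hf : HasJet l h f a)
    (h0 : ∀ t, (a t).c0 = 1) : Ord l h 1 fun t => f t - 1 := by
  refine ((hf.add (const hh (Ord.const hh (-1)))).ord_one hh fun t => ?_).congr'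
    (Eventually.of_forall fun t => by ring)
  simp [h0]

theorem tendsto_one (hh : Tendsto h l (𝓝[>] 0)) (hf : HasJet l h f a)
    (h0 : ∀ t, (a t).c0 = 1) : Tendsto f l (𝓝 1) := by
  have := ((hf.sub_one_ord hh h0).tendsto_zero hh one_pos).add_const 1
  simpa using this

theorem log (hh : Tendsto h l (𝓝[>] 0)) (hf : HasJet l h f a) (h0 : ∀ t, (a t).c0 = 1) :
    HasJet l h (fun t => Real.log (f t)) fun t => (a t).log := by
  have hq1 := hf.sub_one_ord hh h0
  have hc : ∀ c : ℝ, HasJet l h (fun _ => c) fun _ => Jet.const c := fun c =>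
    const hh (Ord.const hh c)
  have q1 := hf.add (hc (-1))
  have q2 := q1.mul hh q1
  have q3 := q2.mul hh q1
  have q4 := q3.mul hh q1
  have q5 := q4.mul hh q1
  have S := (((q1.add ((hc (-1 / 2)).mul hh q2)).add ((hc (1 / 3)).mul hh q3)).add
    ((hc (-1 / 4)).mul hh q4)).add ((hc (1 / 5)).mul hh q5)
  -- With `q = f - 1` of order `1`, the logarithm series cut after `q⁵` has remainder at most `|q|⁶
  -- / (1 - |q|) ≤ 2 |q|⁶` once `|q| < 1/2`.
  have hrem : Ord l h 6 fun t => Real.log (f t) - ((f t - 1) - (f t - 1) ^ 2 / 2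
      + (f t - 1) ^ 3 / 3 - (f t - 1) ^ 4 / 4 + (f t - 1) ^ 5 / 5) := by
    have h6 : Ord l h 6 fun t => (f t - 1) ^ 6 := by
      simpa using hq1.pow hh 6
    refine h6.of_le (IsBigO.of_bound 2 ?_)
    have hev : ∀ᶠ t in l, |f t - 1| < 1 / 2 := by
      have := (hq1.tendsto_zero hh one_pos).abs
      rw [abs_zero] at this
      exact this.eventually (gt_mem_nhds (by norm_num))
    filter_upwards [hev] with t ht
    have hb := Real.abs_log_sub_add_sum_range_le (x := -(f t - 1)) (by rw [abs_neg]; linarith) 5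
    rw [abs_neg] at hb
    have hb2 : |f t - 1| ^ 6 / (1 - |f t - 1|) ≤ 2 * |f t - 1| ^ 6 := by
      rw [div_le_iff₀ (by linarith)]
      nlinarith [pow_nonneg (abs_nonneg (f t - 1)) 6]
    rw [Real.norm_eq_abs, Real.norm_eq_abs, abs_pow]
    refine le_trans (le_of_eq ?_) (hb.trans hb2)
    congr 1
    simp only [Finset.sum_range_succ, Finset.sum_range_zero, sub_neg_eq_add, add_sub_cancel]
    push_cast
    ring
  refine (S.add_ord hrem).congr (Eventually.of_forall fun t => ?_) fun t => ?_
  · ring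
  · ext <;> simp [h0] <;> ring

end HasJet

end Order

/-! ### Abel's equation and its truncated solution. -/

section Abel

/-- The approximate solution `y - b ln y + c₁/y + c₂/y² + c₃/y³` of Abel's equation. -/
noncomputable def abelFun (b c₁ c₂ c₃ y : ℝ) : ℝ :=
  y - b * Real.log y + c₁ / y + c₂ / y ^ 2 + c₃ / y ^ 3

/-- At `y = 1 / (h v²)` the factor `h v² = 1 / y` clears all denominators, and subtracting `b ln h`
removes the singular part of `-b ln y = b ln h + 2 b ln v`. What is left is polynomial in `h`, `v`,
`z` and `ln v`, hence accessible to jets. It serves twice: with `v = f x / x` for Abel's equation,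
and with `h = 1 / n` for the inversion of `A`. -/
theorem abelFun_rescale (b c₁ c₂ c₃ z : ℝ) {h v : ℝ} (hh : 0 < h) (hv : 0 < v) :
    h * (v * v) * (abelFun b c₁ c₂ c₃ (1 / (h * v ^ 2)) - 1 / h - b * Real.log h - z) =
      1 + -1 * (v * v) + 2 * b * (h * (v * v)) * Real.log v
        + c₁ * ((h * (v * v)) * (h * (v * v)))
        + c₂ * (((h * (v * v)) * (h * (v * v))) * (h * (v * v)))
        + c₃ * (((h * (v * v)) * (h * (v * v))) * ((h * (v * v)) * (h * (v * v))))
        + -1 * ((h * (v * v)) * z) := by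
  have h1 : Real.log (1 / (h * v ^ 2)) = -(Real.log h + 2 * Real.log v) := by
    rw [one_div, Real.log_inv, Real.log_mul hh.ne' (by positivity), Real.log_pow]
    push_cast
    ring
  rw [abelFun, h1]
  field_simp
  ring

/-- The jet of the right-hand side of `abelFun_rescale`. -/
noncomputable def abelJet (b c₁ c₂ c₃ : ℝ) (v z : Jet) : Jet :=
  let w := Jet.var.mul (v.mul v)
  let w2 := w.mul w
  ((((((Jet.const 1).add ((Jet.const (-1)).mul (v.mul v))).add
    (((Jet.const (2 * b)).mul w).mul v.log)).add ((Jet.const c₁).mul w2)).add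
    ((Jet.const c₂).mul (w2.mul w))).add ((Jet.const c₃).mul (w2.mul w2))).add
    ((Jet.const (-1)).mul (w.mul z))

variable {α : Type*} {l : Filter α} {h v z : α → ℝ} {V Z : α → Jet} {b c₁ c₂ c₃ : ℝ}

theorem hasJet_abelFun (hh : Tendsto h l (𝓝[>] 0)) (hv : HasJet l h v V)
    (h0 : ∀ t, (V t).c0 = 1) (hz : HasJet l h z Z) :
    HasJet l h (fun t => h t * (v t * v t) *
      (abelFun b c₁ c₂ c₃ (1 / (h t * v t ^ 2)) - 1 / h t - b * Real.log (h t) - z t))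
      fun t => abelJet b c₁ c₂ c₃ (V t) (Z t) := by
  have hc : ∀ c : ℝ, HasJet l h (fun _ => c) fun _ => Jet.const c := fun c =>
    HasJet.const hh (Ord.const hh c)
  have hvv := hv.mul hh hv
  have w := (HasJet.var hh).mul hh hvv
  have w2 := w.mul hh w
  have key := ((((((hc 1).add ((hc (-1)).mul hh hvv)).add
    (((hc (2 * b)).mul hh w).mul hh (hv.log hh h0))).add ((hc c₁).mul hh w2)).add
    ((hc c₂).mul hh (w2.mul hh w))).add ((hc c₃).mul hh (w2.mul hh w2))).add
    ((hc (-1)).mul hh (w.mul hh hz))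
  refine key.congr ?_ fun t => rfl
  have hpos : ∀ᶠ t in l, 0 < v t :=
    (hv.tendsto_one hh h0).eventually (lt_mem_nhds one_pos)
  filter_upwards [hh.eventually self_mem_nhdsWithin, hpos] with t h1 h2
  exact (abelFun_rescale b c₁ c₂ c₃ (z t) h1 h2).symm

/-- Since `v → 1`, the factor `h v²` is comparable to `h`, and removing it costs exactly one order.
-/
theorem ord_of_scale_mul (hh : Tendsto h l (𝓝[>] 0)) (hv : Tendsto v l (𝓝 1)) {k : ℝ}
    {f : α → ℝ} (hf : Ord l h (k + 1) fun t => h t * (v t * v t) * f t) : Ord l h k f := by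
  have h1 : Ord l h (-1) fun t => (h t)⁻¹ := by
    refine Ord.of_isBigO hh (IsBigO.of_bound 1 ?_)
    filter_upwards with t
    rw [Real.rpow_neg_one, one_mul]
  have h2 : Ord l h 0 fun t => (v t * v t)⁻¹ := by
    refine Ord.of_isBigO hh ?_
    have : Tendsto (fun t => (v t * v t)⁻¹) l (𝓝 (1 * 1)⁻¹) :=
      (hv.mul hv).inv₀ (by norm_num)
    simpa using this.isBigO_one ℝ
  have := (h1.mul hh h2).mul hh hf
  rw [show -1 + 0 + (k + 1) = k by ring] at this
  refine this.congr' ?_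
  filter_upwards [hh.eventually self_mem_nhdsWithin,
    hv.eventually (lt_mem_nhds one_pos)] with t h1 h2
  have h1' : 0 < h t := h1
  field_simp

/-- A condition on the jet of `v` under which `y ↦ y / v²`, with `y = 1 / h`, increases the
approximate Abel function by `1`. -/
theorem abelFun_diff_ord (hh : Tendsto h l (𝓝[>] 0)) (hv : HasJet l h v V)
    (h0 : ∀ t, (V t).c0 = 1)
    (hJ : ∀ t, abelJet b c₁ c₂ c₃ (V t) ⟨1, c₁, c₂, c₃, 0, 0⟩ = ⟨0, 0, 0, 0, 0, 0⟩) :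
    Ord l h 5 fun t => abelFun b c₁ c₂ c₃ (1 / (h t * v t ^ 2))
      - abelFun b c₁ c₂ c₃ (1 / h t) - 1 := by
  have hc : ∀ c : ℝ, HasJet l h (fun _ => c) fun _ => Jet.const c := fun c =>
    HasJet.const hh (Ord.const hh c)
  have x := HasJet.var hh
  -- The choice `z = 1 + c₁ h + c₂ h² + c₃ h³` makes `1 / h + b ln h + z` equal to `A (1 / h) + 1`.
  have hz := (((hc 1).add ((hc c₁).mul hh x)).add ((hc c₂).mul hh (x.mul hh x))).add
    ((hc c₃).mul hh (x.mul hh (x.mul hh x)))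
  replace hz := hz.congr (b := fun _ => ⟨1, c₁, c₂, c₃, 0, 0⟩) EventuallyEq.rfl
    (fun t => by ext <;> simp)
  have key := hasJet_abelFun (b := b) (c₁ := c₁) (c₂ := c₂) (c₃ := c₃) hh hv h0 hz
  have h6 := key.ord_six (fun t => by rw [hJ]) (fun t => by rw [hJ]) (fun t => by rw [hJ])
    (fun t => by rw [hJ]) (fun t => by rw [hJ]) (fun t => by rw [hJ])
  have h5 := ord_of_scale_mul hh (hv.tendsto_one hh h0) (k := 5) (by norm_num; exact h6)
  refine h5.congr' ?_
  filter_upwards [hh.eventually self_mem_nhdsWithin] with t ht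
  have ht' : 0 < h t := ht
  have : abelFun b c₁ c₂ c₃ (1 / h t) =
      1 / h t + b * Real.log (h t) + c₁ * h t + c₂ * h t ^ 2 + c₃ * h t ^ 3 := by
    rw [abelFun, one_div, Real.log_inv]
    field_simp
    ring
  rw [this]
  ring

/-- The numbers `b₁, c₁, c₂, c₃` delivered by the algorithm solve Abel's equation to the required
order. The third jet is `tanh x / x` in powers of `h = 2 x² / 3`. -/
theorem abelJet_tanh : abelJet (3 / 20) (47 / 2800) (-3 / 16000) (-83723 / 86240000)
    ⟨1, -1 / 3 * (3 / 2), 2 / 15 * (3 / 2) ^ 2, -17 / 315 * (3 / 2) ^ 3,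
      62 / 2835 * (3 / 2) ^ 4, -1382 / 155925 * (3 / 2) ^ 5⟩
    ⟨1, 47 / 2800, -3 / 16000, -83723 / 86240000, 0, 0⟩ = ⟨0, 0, 0, 0, 0, 0⟩ := by
  ext <;> norm_num [abelJet]

theorem abelJet_arctan : abelJet (-3 / 20) (47 / 2800) (3 / 16000) (-83723 / 86240000)
    ⟨1, -1 / 3 * (3 / 2), 1 / 5 * (3 / 2) ^ 2, -1 / 7 * (3 / 2) ^ 3,
      1 / 9 * (3 / 2) ^ 4, -1 / 11 * (3 / 2) ^ 5⟩
    ⟨1, 47 / 2800, 3 / 16000, -83723 / 86240000, 0, 0⟩ = ⟨0, 0, 0, 0, 0, 0⟩ := by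
  ext <;> norm_num [abelJet]

/-- The polynomials `P₂, P₃, P₄`; the sign `ε` is `1` for `tanh` and `-1` for `arctan`. -/
noncomputable def seriesJet (ε x : ℝ) : Jet :=
  ⟨1, x, 3 / 2 * x ^ 2 + 3 / 20 * ε * x + 47 / 5600,
    5 / 2 * x ^ 3 + 3 / 5 * ε * x ^ 2 + 361 / 5600 * x + 261 / 224000 * ε,
    35 / 8 * x ^ 4 + 71 / 40 * ε * x ^ 3 + 101 / 320 * x ^ 2 + 3993 / 224000 * ε * x
      - 44217 / 689920000, 0⟩

/-- The equation that `P₂, P₃, P₄` must satisfy to invert `A`, identically in `x = P₁`. The fifth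
coefficient is left out, as it would involve `P₅`. -/
theorem abelJet_series {ε : ℝ} (hε : ε = 1 ∨ ε = -1) (x : ℝ) :
    let J := abelJet (3 / 20 * ε) (47 / 2800) (-3 / 16000 * ε) (-83723 / 86240000)
      (seriesJet ε x) (Jet.const (-2 * x))
    J.c0 = 0 ∧ J.c1 = 0 ∧ J.c2 = 0 ∧ J.c3 = 0 ∧ J.c4 = 0 := by
  rcases hε with rfl | rfl <;> refine ⟨?_, ?_, ?_, ?_, ?_⟩ <;> simp [abelJet, seriesJet] <;> ring

end Abel

/-! ### Taylor expansions of `tanh` and `arctan` at the origin. -/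

section Taylor

/-- The mean value inequality on the ball of radius `|x|`. -/
theorem isBigO_pow_succ_of_deriv {d d' : ℝ → ℝ} (hd : ∀ x, HasDerivAt d (d' x) x) (h0 : d 0 = 0)
    {k : ℕ} (hk : d' =O[𝓝 0] fun x : ℝ => x ^ k) : d =O[𝓝 0] fun x : ℝ => x ^ (k + 1) := by
  obtain ⟨c, hc, hb⟩ := hk.exists_nonneg
  obtain ⟨ε, hε, hball⟩ := Metric.eventually_nhds_iff_ball.1 hb.bound
  refine IsBigO.of_bound c (Metric.eventually_nhds_iff_ball.2 ⟨ε, hε, fun x hx => ?_⟩)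
  have key := (convex_closedBall (0 : ℝ) ‖x‖).norm_image_sub_le_of_norm_hasDerivWithin_le
    (f := d) (f' := d') (C := c * ‖x‖ ^ k) (x := 0) (y := x)
    (fun y _ => (hd y).hasDerivWithinAt) (fun y hy => ?_) (by simp) (by simp)
  · rwa [h0, sub_zero, sub_zero, mul_assoc, ← pow_succ, ← norm_pow] at key
  · have hy' : ‖y‖ ≤ ‖x‖ := by simpa using hy
    have hx' : ‖x‖ < ε := by simpa using hx
    refine (hball y (by simpa using hy'.trans_lt hx')).trans ?_
    rw [norm_pow]
    gcongr

/-- The Taylor polynomial of `TaylorStart` for `τ = 2`. -/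
noncomputable def taylorPoly (a : ℕ → ℚ) (x : ℝ) : ℝ :=
  x + ∑ m ∈ Finset.Icc 1 7, (a m : ℝ) * x ^ (m * 2 + 1)

theorem taylorPoly_hasDerivAt (a : ℕ → ℚ) (x : ℝ) : HasDerivAt (taylorPoly a)
    (1 + ∑ m ∈ Finset.Icc 1 7, (a m : ℝ) * ((m * 2 + 1 : ℕ) * x ^ (m * 2))) x := by
  refine (hasDerivAt_id x).add (HasDerivAt.fun_sum fun m _ => ?_)
  simpa using (hasDerivAt_pow (m * 2 + 1) x).const_mul (a m : ℝ)

theorem taylorPoly_zero (a : ℕ → ℚ) : taylorPoly a 0 = 0 := by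
  simp [taylorPoly]

theorem hasDerivAt_tanh (x : ℝ) : HasDerivAt Real.tanh (1 - Real.tanh x ^ 2) x := by
  have h := (Real.hasDerivAt_sinh x).div (Real.hasDerivAt_cosh x) (Real.cosh_pos x).ne'
  have hf : Real.sinh / Real.cosh = Real.tanh := by
    ext y; simp [Real.tanh_eq_sinh_div_cosh]
  rw [hf] at h
  refine h.congr_deriv ?_
  have := (Real.cosh_pos x).ne'
  rw [Real.tanh_eq_sinh_div_cosh]
  field_simp

theorem isBigO_pow_mul {k : ℕ} {f g : ℝ → ℝ} (hg : ContinuousAt g 0)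
    (hf : ∀ x, f x = x ^ k * g x) : f =O[𝓝 0] fun x : ℝ => x ^ k := by
  have := (isBigO_refl (fun x : ℝ => x ^ k) (𝓝 0)).mul (hg.tendsto.isBigO_one ℝ)
  simpa [← hf] using this

theorem isBigO_pow_of_le {k n : ℕ} (h : k ≤ n) :
    (fun x : ℝ => x ^ n) =O[𝓝 0] fun x : ℝ => x ^ k :=
  isBigO_pow_mul (g := fun x => x ^ (n - k)) (by fun_prop) fun x => by
    rw [← pow_add, Nat.add_sub_cancel' h]

/-- Bootstrap on `tanh' = 1 - tanh²`: with `Q` the Taylor polynomial, the error `d` satisfies `d' =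
(1 - Q' - Q²) - d (Q + tanh)`. The bracket is `O(x ^ 16)`, so `d = O(x ^ k)` improves to `d = O(x ^
(k + 1))` as long as `k ≤ 16`. -/
theorem taylorStart_tanh : TaylorStart Real.tanh 2 tanhA := by
  set d : ℝ → ℝ := fun x => Real.tanh x - taylorPoly tanhA x with hd
  set Q' : ℝ → ℝ := fun x =>
    1 + ∑ m ∈ Finset.Icc 1 7, (tanhA m : ℝ) * ((m * 2 + 1 : ℕ) * x ^ (m * 2)) with hQ'
  have hcQ : Continuous (taylorPoly tanhA) :=
    continuous_iff_continuousAt.2 fun x => (taylorPoly_hasDerivAt _ x).continuousAt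
  have hct : Continuous Real.tanh :=
    continuous_iff_continuousAt.2 fun x => (hasDerivAt_tanh x).continuousAt
  have hres : (fun x => 1 - Q' x - taylorPoly tanhA x ^ 2) =O[𝓝 0] fun x : ℝ => x ^ 16 := by
    -- The explicit quotient of the polynomial `1 - Q' - Q²` by `x ^ 16`.
    refine isBigO_pow_mul (g := fun x => (6404582 / 638512875) + (-19328158 / 5746615875) * x ^ 2 +
      (33434188 / 28733079375) * x ^ 4 + (-521443646 / 1327468267125) * x ^ 6 + (2535845252 /
        19912024006875) * x ^ 8 + (-16700628356 / 431427186815625) * x ^ 10 + (40611010472 /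
          3882844681340625) * x ^ 12 + (-864098525761 / 407698691540765625) * x ^ 14) (by fun_prop)
            fun x => ?_
    simp [hQ', taylorPoly, Finset.sum_Icc_succ_top, tanhA]
    ring
  have hder : ∀ x, HasDerivAt d ((1 - Q' x - taylorPoly tanhA x ^ 2)
      - d x * (taylorPoly tanhA x + Real.tanh x)) x := fun x => by
    refine ((hasDerivAt_tanh x).sub (taylorPoly_hasDerivAt tanhA x)).congr_deriv ?_
    simp only [hd, hQ']
    ring
  have hd0 : d 0 = 0 := by simp [hd, taylorPoly_zero]
  have key : ∀ k ≤ 17, d =O[𝓝 0] fun x : ℝ => x ^ k := by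
    intro k
    induction k with
    | zero =>
      intro _
      have : ContinuousAt d 0 := (hct.sub hcQ).continuousAt
      simpa using this.tendsto.isBigO_one ℝ
    | succ k ih =>
      intro hk
      refine isBigO_pow_succ_of_deriv hder hd0 ((hres.trans ?_).sub ?_)
      · exact isBigO_pow_of_le (by omega)
      · have h1 : (fun x => taylorPoly tanhA x + Real.tanh x) =O[𝓝 0] fun _ => (1 : ℝ) :=
          (hcQ.add hct).continuousAt.tendsto.isBigO_one ℝ
        simpa using (ih (by omega)).mul h1
  exact key 17 le_rfl

/-- Differentiation turns the claim into the finite geometric series, whose remainder is `x ^ 16 /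
(1 + x²)`. -/
theorem taylorStart_arctan : TaylorStart Real.arctan 2 arctanA := by
  refine isBigO_pow_succ_of_deriv (k := 16)
    (fun x => (Real.hasDerivAt_arctan x).sub (taylorPoly_hasDerivAt arctanA x))
    (by simp [taylorPoly_zero]) (isBigO_pow_mul (g := fun x => 1 / (1 + x ^ 2)) ?_ fun x => ?_)
  · exact continuousAt_const.div (by fun_prop) (by norm_num)
  · have : (1 + x ^ 2) ≠ 0 := by positivity
    simp [Finset.sum_Icc_succ_top, arctanA]
    field_simp
    ring

theorem tendsto_scale : Tendsto (fun x : ℝ => 2 / 3 * x ^ 2) (𝓝[>] 0) (𝓝[>] 0) := by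
  refine tendsto_nhdsWithin_iff.2 ⟨?_, ?_⟩
  · have : ContinuousAt (fun x : ℝ => 2 / 3 * x ^ 2) 0 := by fun_prop
    have h := this.tendsto
    norm_num at h
    exact h.mono_left nhdsWithin_le_nhds
  · filter_upwards [self_mem_nhdsWithin] with x hx
    have : (0 : ℝ) < x := hx
    simp only [Set.mem_Ioi]
    positivity

/-- Substitution of `x² = (3/2) h`; the terms with `a₆` and `a₇` are already `O(x ^ 12) = O(h ^ 6)`.
-/
theorem TaylorStart.hasJet {f : ℝ → ℝ} {a : ℕ → ℚ} (hf : TaylorStart f 2 a) :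
    HasJet (𝓝[>] 0) (fun x : ℝ => 2 / 3 * x ^ 2) (fun x => f x / x)
      fun _ => ⟨1, a 1 * (3 / 2), a 2 * (3 / 2) ^ 2, a 3 * (3 / 2) ^ 3, a 4 * (3 / 2) ^ 4,
        a 5 * (3 / 2) ^ 5⟩ := by
  have hh := tendsto_scale
  refine ⟨Ord.const hh _, Ord.const hh _, Ord.const hh _, Ord.const hh _, Ord.const hh _,
    Ord.const hh _, Ord.of_isBigO hh ?_⟩
  have h1 : (fun x : ℝ => f x - (x + ∑ m ∈ Finset.Icc 1 7, (a m : ℝ) * x ^ (m * 2 + 1))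
      + ((a 6 : ℝ) * x ^ 13 + (a 7 : ℝ) * x ^ 15)) =O[𝓝 0] fun x : ℝ => x ^ 13 :=
    (hf.trans (isBigO_pow_of_le (by norm_num))).add
      (isBigO_pow_mul (g := fun x => (a 6 : ℝ) + (a 7 : ℝ) * x ^ 2) (by fun_prop)
        fun x => by ring)
  have h2 := (h1.mono (nhdsWithin_le_nhds (s := Set.Ioi 0))).mul
    (isBigO_refl (fun x : ℝ => x⁻¹) _)
  refine IsBigO.trans (g := fun x : ℝ => x ^ 12) (h2.congr' ?_ ?_)
    (IsBigO.of_bound ((3 / 2) ^ 6) ?_)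
  · filter_upwards [self_mem_nhdsWithin] with x hx
    have : x ≠ 0 := (show (0 : ℝ) < x from hx).ne'
    simp only [Jet.eval, Finset.sum_Icc_succ_top, Finset.Icc_self, Finset.sum_singleton,
      Nat.reduceLeDiff]
    field_simp
    simp
    ring
  · filter_upwards [self_mem_nhdsWithin] with x hx
    have : x ≠ 0 := (show (0 : ℝ) < x from hx).ne'
    field_simp
  · filter_upwards with x
    rw [show (6 : ℝ) = ((6 : ℕ) : ℝ) by norm_num, Real.rpow_natCast,
      show x ^ 12 = (3 / 2) ^ 6 * (2 / 3 * x ^ 2) ^ 6 by ring, norm_mul,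
      Real.norm_of_nonneg (show (0 : ℝ) ≤ (3 / 2) ^ 6 by positivity)]

end Taylor

/-! ### Orbits: convergence to zero and the limit of the Abel coordinate. -/

section Iteration

theorem iterate_pos {f : ℝ → ℝ} (hf : ∀ x, 0 < x → 0 < f x) {x₀ : ℝ} (hx : 0 < x₀) (n : ℕ) :
    0 < f^[n] x₀ := by
  induction n with
  | zero => exact hx
  | succ n ih => rw [Function.iterate_succ_apply']; exact hf _ ih

/-- The orbit decreases to a fixed point, and a positive fixed point would contradict `f x < x`. -/
theorem tendsto_iterate_zero {f : ℝ → ℝ} (hc : Continuous f) (hf : ∀ x, 0 < x → 0 < f x)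
    (hlt : ∀ x, 0 < x → f x < x) {x₀ : ℝ} (hx : 0 < x₀) :
    Tendsto (fun n => f^[n] x₀) atTop (𝓝[>] 0) := by
  have hpos := iterate_pos hf hx
  have hanti : Antitone fun n => f^[n] x₀ := antitone_nat_of_succ_le fun n => by
    rw [Function.iterate_succ_apply']
    exact (hlt _ (hpos n)).le
  have hlim := tendsto_atTop_ciInf hanti ⟨0, by rintro _ ⟨n, rfl⟩; exact (hpos n).le⟩
  set L := ⨅ n, f^[n] x₀
  have hL : 0 ≤ L := ge_of_tendsto' hlim fun n => (hpos n).le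
  have hfix : f L = L := isFixedPt_of_tendsto_iterate hlim hc.continuousAt
  have hL0 : L = 0 := by
    rcases hL.eq_or_lt with h | h
    · exact h.symm
    · exact absurd hfix (hlt L h).ne
  rw [hL0] at hlim
  exact tendsto_nhdsWithin_iff.2 ⟨hlim, Eventually.of_forall hpos⟩

/-- The distance to the limit is at most the tail of the differences. For `k ≥ n`, `k ^ (-9/2) ≤ n⁻³
k ^ (-3/2)`, and the tail of the convergent series `∑ k ^ (-3/2)` supplies the `o(1)` in front of
`n⁻³`. -/
theorem exists_isLittleO_sub_of_diff {u : ℕ → ℝ}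
    (hu : (fun n => u (n + 1) - u n) =O[atTop] fun n : ℕ => (n : ℝ) ^ (-(9 / 2) : ℝ)) :
    ∃ K : ℝ, (fun n => u n - K) =o[atTop] fun n : ℕ => (n : ℝ) ^ (-3 : ℝ) := by
  have hs : Summable fun n => dist (u n) (u n.succ) := by
    refine summable_of_isBigO_nat (g := fun n : ℕ => (n : ℝ) ^ (-(9 / 2) : ℝ))
      (Real.summable_nat_rpow.2 (by norm_num)) ?_
    refine hu.norm_left.congr_left fun n => ?_
    rw [dist_comm, Real.dist_eq, Real.norm_eq_abs]
  obtain ⟨K, hK⟩ := cauchySeq_tendsto_of_complete (cauchySeq_of_summable_dist hs)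
  refine ⟨K, ?_⟩
  obtain ⟨c, hc, hb⟩ := hu.exists_pos
  obtain ⟨N, hN⟩ := eventually_atTop.1 hb.bound
  have hs2 : Summable fun n : ℕ => (n : ℝ) ^ (-(3 / 2) : ℝ) :=
    Real.summable_nat_rpow.2 (by norm_num)
  have htail : Tendsto (fun n : ℕ => c * ∑' k : ℕ, ((k + n : ℕ) : ℝ) ^ (-(3 / 2) : ℝ)) atTop
      (𝓝 0) := by
    simpa using (tendsto_sum_nat_add fun n : ℕ => (n : ℝ) ^ (-(3 / 2) : ℝ)).const_mul c
  have hlo : (fun n : ℕ => (c * ∑' k : ℕ, ((k + n : ℕ) : ℝ) ^ (-(3 / 2) : ℝ))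
      * (n : ℝ) ^ (-3 : ℝ)) =o[atTop] fun n : ℕ => (n : ℝ) ^ (-3 : ℝ) := by
    simpa using ((isLittleO_one_iff ℝ).2 htail).mul_isBigO
      (isBigO_refl (fun n : ℕ => (n : ℝ) ^ (-3 : ℝ)) atTop)
  refine IsBigO.trans_isLittleO (IsBigO.of_bound 1 ?_) hlo
  filter_upwards [eventually_ge_atTop (max N 1)] with n hn
  have hnN : N ≤ n := le_trans (le_max_left _ _) hn
  have hn1 : 1 ≤ n := le_trans (le_max_right _ _) hn
  have hn0 : (0 : ℝ) < n := by exact_mod_cast hn1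
  have hterm : ∀ k : ℕ, dist (u (n + k)) (u (n + k).succ) ≤
      c * (n : ℝ) ^ (-3 : ℝ) * ((k + n : ℕ) : ℝ) ^ (-(3 / 2) : ℝ) := by
    intro k
    have h1 := hN (n + k) (by omega)
    have hnk : (0 : ℝ) < ((n + k : ℕ) : ℝ) := by exact_mod_cast (by omega : 0 < n + k)
    rw [Real.norm_of_nonneg (Real.rpow_nonneg hnk.le _)] at h1
    rw [dist_comm, Real.dist_eq, ← Real.norm_eq_abs]
    refine h1.trans ?_
    rw [mul_assoc, add_comm k n]
    refine mul_le_mul_of_nonneg_left ?_ hc.le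
    rw [show (-(9 / 2) : ℝ) = -3 + -(3 / 2) by norm_num, Real.rpow_add hnk]
    refine mul_le_mul_of_nonneg_right ?_ (Real.rpow_nonneg hnk.le _)
    exact Real.rpow_le_rpow_of_nonpos hn0 (by push_cast; linarith [Nat.cast_nonneg (α := ℝ) k])
      (by norm_num)
  have hsn : Summable fun k : ℕ => ((k + n : ℕ) : ℝ) ^ (-(3 / 2) : ℝ) :=
    (summable_nat_add_iff n).2 hs2
  have hle := dist_le_tsum_dist_of_tendsto hs hK n
  have hle2 : ∑' k, dist (u (n + k)) (u (n + k).succ) ≤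
      c * (n : ℝ) ^ (-3 : ℝ) * ∑' k : ℕ, ((k + n : ℕ) : ℝ) ^ (-(3 / 2) : ℝ) := by
    rw [← tsum_mul_left]
    refine Summable.tsum_le_tsum hterm ?_ (hsn.mul_left _)
    have := (summable_nat_add_iff n).2 hs
    simpa only [add_comm] using this
  rw [Real.dist_eq] at hle
  rw [one_mul, Real.norm_eq_abs]
  refine (hle.trans hle2).trans (le_trans (le_of_eq ?_) (le_abs_self _))
  ring

theorem tendsto_abelFun_div (b c₁ c₂ c₃ : ℝ) :
    Tendsto (fun y => abelFun b c₁ c₂ c₃ y / y) atTop (𝓝 1) := by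
  have h1 : Tendsto (fun y : ℝ => y⁻¹) atTop (𝓝 0) := tendsto_inv_atTop_zero
  have h2 : Tendsto (fun y : ℝ => Real.log y / y) atTop (𝓝 0) :=
    Real.isLittleO_log_id_atTop.tendsto_div_nhds_zero
  have h3 : Tendsto (fun y : ℝ => 1 - b * (Real.log y / y) + c₁ * (y⁻¹) ^ 2 + c₂ * (y⁻¹) ^ 3
      + c₃ * (y⁻¹) ^ 4) atTop (𝓝 (1 - b * 0 + c₁ * 0 ^ 2 + c₂ * 0 ^ 3 + c₃ * 0 ^ 4)) :=
    ((((h2.const_mul b).const_sub 1).add ((h1.pow 2).const_mul c₁)).add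
      ((h1.pow 3).const_mul c₂)).add ((h1.pow 4).const_mul c₃)
  have h4 : (1 : ℝ) - b * 0 + c₁ * 0 ^ 2 + c₂ * 0 ^ 3 + c₃ * 0 ^ 4 = 1 := by ring
  rw [h4] at h3
  refine h3.congr' ?_
  filter_upwards [eventually_gt_atTop 0] with y hy
  rw [abelFun]
  field_simp

theorem abelFun_hasDerivAt (b c₁ c₂ c₃ : ℝ) {y : ℝ} (hy : y ≠ 0) :
    HasDerivAt (abelFun b c₁ c₂ c₃)
      (1 - b * y⁻¹ - c₁ * y⁻¹ ^ 2 - 2 * c₂ * y⁻¹ ^ 3 - 3 * c₃ * y⁻¹ ^ 4) y := by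
  have h := ((((hasDerivAt_id y).sub ((Real.hasDerivAt_log hy).const_mul b)).add
    ((hasDerivAt_const y c₁).div (hasDerivAt_id y) hy)).add
    ((hasDerivAt_const y c₂).div (hasDerivAt_pow 2 y) (pow_ne_zero 2 hy))).add
    ((hasDerivAt_const y c₃).div (hasDerivAt_pow 3 y) (pow_ne_zero 3 hy))
  refine h.congr_deriv ?_
  simp only [id]
  field_simp
  ring

/-- The derivative of `A` tends to `1`, so `A y - y / 2` is increasing for large `y`. This transfers
estimates from `A` back to its argument. -/
theorem exists_abelFun_expanding (b c₁ c₂ c₃ : ℝ) : ∃ Y : ℝ, ∀ y z, Y ≤ y → Y ≤ z →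
    |y - z| ≤ 2 * |abelFun b c₁ c₂ c₃ y - abelFun b c₁ c₂ c₃ z| := by
  have h1 : Tendsto (fun y : ℝ => y⁻¹) atTop (𝓝 0) := tendsto_inv_atTop_zero
  have h3 : Tendsto (fun y : ℝ => 1 - b * y⁻¹ - c₁ * y⁻¹ ^ 2 - 2 * c₂ * y⁻¹ ^ 3
      - 3 * c₃ * y⁻¹ ^ 4) atTop
      (𝓝 (1 - b * 0 - c₁ * 0 ^ 2 - 2 * c₂ * 0 ^ 3 - 3 * c₃ * 0 ^ 4)) :=
    ((((h1.const_mul b).const_sub 1).sub ((h1.pow 2).const_mul c₁)).sub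
      ((h1.pow 3).const_mul (2 * c₂))).sub ((h1.pow 4).const_mul (3 * c₃))
  have h4 : (1 : ℝ) - b * 0 - c₁ * 0 ^ 2 - 2 * c₂ * 0 ^ 3 - 3 * c₃ * 0 ^ 4 = 1 := by ring
  rw [h4] at h3
  obtain ⟨Y, hY⟩ := eventually_atTop.1
    ((h3.eventually (lt_mem_nhds (show (1 / 2 : ℝ) < 1 by norm_num))).and
      (eventually_gt_atTop 0))
  have hder : ∀ y, Y ≤ y → HasDerivAt (fun y => abelFun b c₁ c₂ c₃ y - 1 / 2 * y)
      ((1 - b * y⁻¹ - c₁ * y⁻¹ ^ 2 - 2 * c₂ * y⁻¹ ^ 3 - 3 * c₃ * y⁻¹ ^ 4) - 1 / 2 * 1) y :=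
    fun y hy => (abelFun_hasDerivAt b c₁ c₂ c₃ (hY y hy).2.ne').sub
      ((hasDerivAt_id y).const_mul (1 / 2))
  have hmono : MonotoneOn (fun y => abelFun b c₁ c₂ c₃ y - 1 / 2 * y) (Set.Ici Y) := by
    refine monotoneOn_of_deriv_nonneg (convex_Ici Y)
      (fun y hy => (hder y hy).continuousAt.continuousWithinAt)
      (fun y hy => (hder y (interior_subset hy)).differentiableAt.differentiableWithinAt)
      fun y hy => ?_
    rw [(hder y (interior_subset hy)).deriv]
    linarith [(hY y (interior_subset hy)).1]
  have key : ∀ y z, Y ≤ y → y ≤ z →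
      |y - z| ≤ 2 * |abelFun b c₁ c₂ c₃ y - abelFun b c₁ c₂ c₃ z| := by
    intro y z hy hyz
    have := hmono hy (hy.trans hyz) hyz
    simp only at this
    rw [abs_sub_comm, abs_of_nonneg (by linarith), abs_sub_comm (abelFun _ _ _ _ y),
      abs_of_nonneg (by linarith)]
    linarith
  refine ⟨Y, fun y z hy hz => ?_⟩
  rcases le_total y z with h | h
  · exact key y z hy h
  · rw [abs_sub_comm, abs_sub_comm (abelFun _ _ _ _ y)]
    exact key z y hz h

variable {f : ℝ → ℝ} {b c₁ c₂ c₃ : ℝ}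

theorem tendsto_iterate_inv_sq {x : ℕ → ℝ} (hx : Tendsto x atTop (𝓝[>] 0)) :
    Tendsto (fun n => 1 / (2 / 3 * x n ^ 2)) atTop atTop := by
  have := (tendsto_scale.comp hx).inv_tendsto_nhdsGT_zero
  exact this.congr fun n => by simp

/-- Cesàro means of the differences give `A yₙ / n → 1`, and `A y / y → 1` at infinity. -/
theorem tendsto_div_of_diff {y : ℕ → ℝ} (hy : Tendsto y atTop atTop)
    (hd : Tendsto (fun n => abelFun b c₁ c₂ c₃ (y (n + 1)) - abelFun b c₁ c₂ c₃ (y n))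
      atTop (𝓝 1)) : Tendsto (fun n : ℕ => y n / n) atTop (𝓝 1) := by
  have h1 : Tendsto (fun n : ℕ => abelFun b c₁ c₂ c₃ (y n) / n) atTop (𝓝 1) := by
    have h := hd.cesaro
    simp only [Finset.sum_range_sub (fun n => abelFun b c₁ c₂ c₃ (y n))] at h
    have h0 : Tendsto (fun n : ℕ => (n : ℝ)⁻¹ * abelFun b c₁ c₂ c₃ (y 0)) atTop (𝓝 0) := by
      simpa using (tendsto_inv_atTop_zero.comp tendsto_natCast_atTop_atTop).mul_const
        (abelFun b c₁ c₂ c₃ (y 0))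
    have := h.add h0
    rw [add_zero] at this
    refine this.congr fun n => ?_
    ring
  have h2 := (tendsto_abelFun_div b c₁ c₂ c₃).comp hy
  have h3 := h1.div h2 one_ne_zero
  rw [div_one] at h3
  refine h3.congr' ?_
  have h4 : ∀ᶠ n in atTop, abelFun b c₁ c₂ c₃ (y n) / y n ≠ 0 :=
    h2.eventually_ne one_ne_zero
  filter_upwards [h4] with n hn
  have : abelFun b c₁ c₂ c₃ (y n) ≠ 0 := fun h => hn (by rw [h, zero_div])
  have h5 : y n ≠ 0 := fun h => hn (by rw [h, div_zero])
  simp only [Pi.div_apply, Function.comp_apply]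
  field_simp

/-- The asymptotic behaviour of the approximate Abel function along an orbit. -/
theorem exists_abelFun_iterate {x : ℕ → ℝ} (hx : Tendsto x atTop (𝓝[>] 0))
    (hrec : ∀ n, x (n + 1) = f (x n))
    (hΦ : Ord (𝓝[>] 0) (fun x : ℝ => 2 / 3 * x ^ 2) 5 fun x =>
      abelFun b c₁ c₂ c₃ (1 / (2 / 3 * f x ^ 2)) - abelFun b c₁ c₂ c₃ (1 / (2 / 3 * x ^ 2)) - 1) :
    Tendsto (fun n : ℕ => 1 / (2 / 3 * x n ^ 2) / n) atTop (𝓝 1) ∧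
    ∃ K : ℝ, (fun n : ℕ => abelFun b c₁ c₂ c₃ (1 / (2 / 3 * x n ^ 2)) - n - K)
      =o[atTop] fun n : ℕ => (n : ℝ) ^ (-3 : ℝ) := by
  have hG : ∀ n, abelFun b c₁ c₂ c₃ (1 / (2 / 3 * f (x n) ^ 2)) =
      abelFun b c₁ c₂ c₃ (1 / (2 / 3 * x (n + 1) ^ 2)) := fun n => by rw [hrec]
  have hdiv : Tendsto (fun n : ℕ => 1 / (2 / 3 * x n ^ 2) / n) atTop (𝓝 1) := by
    refine tendsto_div_of_diff (b := b) (c₁ := c₁) (c₂ := c₂) (c₃ := c₃)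
      (tendsto_iterate_inv_sq hx) ?_
    have := ((hΦ.tendsto_zero tendsto_scale (by norm_num)).comp hx).add_const 1
    rw [zero_add] at this
    refine this.congr fun n => ?_
    simp only [Function.comp_apply, hG]
    ring
  refine ⟨hdiv, ?_⟩
  -- Order `5` gives only exponents below `5`; `9/2` is enough. Since `1 / h = yₙ ~ n`, powers of
  -- `h` turn into powers of `1 / n`.
  have hO := ((hΦ.isLittleO tendsto_scale (m := 9 / 2) (by norm_num)).comp_tendsto hx).isBigO
  have hpow : (fun n => (2 / 3 * x n ^ 2) ^ (9 / 2 : ℝ)) =O[atTop]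
      fun n : ℕ => (n : ℝ) ^ (-(9 / 2) : ℝ) := by
    refine IsBigO.of_bound (2 ^ (9 / 2 : ℝ)) ?_
    filter_upwards [hdiv.eventually (lt_mem_nhds (show (1 / 2 : ℝ) < 1 by norm_num)),
      eventually_gt_atTop 0, hx.eventually self_mem_nhdsWithin] with n hn hn0 hxn
    have hn0' : (0 : ℝ) < n := by exact_mod_cast hn0
    have hxn' : 0 < x n := hxn
    rw [Real.norm_of_nonneg (by positivity), Real.norm_of_nonneg (by positivity),
      Real.rpow_neg hn0'.le, ← div_eq_mul_inv, ← Real.div_rpow (by norm_num) hn0'.le]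
    refine Real.rpow_le_rpow (by positivity) ?_ (by norm_num)
    rw [lt_div_iff₀ hn0', lt_div_iff₀ (by positivity)] at hn
    rw [le_div_iff₀ hn0']
    linarith
  obtain ⟨K, hK⟩ := exists_isLittleO_sub_of_diff
    (u := fun n => abelFun b c₁ c₂ c₃ (1 / (2 / 3 * x n ^ 2)) - n)
    ((hO.trans hpow).congr_left fun n => by
      simp only [Function.comp_apply, hG]
      push_cast
      ring)
  exact ⟨K, hK⟩

end Iteration

/-! ### Inversion of the Abel function and the expansion of the orbit. -/

section Expansion

theorem tendsto_natCast_inv : Tendsto (fun n : ℕ => (n : ℝ)⁻¹) atTop (𝓝[>] 0) :=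
  tendsto_inv_atTop_nhdsGT_zero.comp tendsto_natCast_atTop_atTop

theorem ord_log : Ord atTop (fun n : ℕ => (n : ℝ)⁻¹) 0 fun n : ℕ => Real.log n := by
  intro δ hδ
  refine ((isLittleO_log_rpow_atTop hδ).comp_tendsto tendsto_natCast_atTop_atTop).isBigO.congr_right
    fun n => ?_
  simp only [Function.comp_apply]
  rw [Real.inv_rpow (Nat.cast_nonneg n), ← Real.rpow_neg (Nat.cast_nonneg n)]
  congr 1
  ring

/-- The argument of the polynomials `P_m` in the expansion. -/
noncomputable def seriesArg (ε K : ℝ) (n : ℕ) : ℝ :=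
  -(1 / 2) * (3 / 20 * ε * Real.log n + K)

/-- The factor `1 + ∑ P_m / n ^ m` of the expansion. -/
noncomputable def seriesVal (ε K : ℝ) (n : ℕ) : ℝ :=
  (seriesJet ε (seriesArg ε K n)).eval (n : ℝ)⁻¹

theorem hasJet_seriesVal (ε K : ℝ) : HasJet atTop (fun n : ℕ => (n : ℝ)⁻¹) (seriesVal ε K)
    fun n => seriesJet ε (seriesArg ε K n) := by
  have hh := tendsto_natCast_inv
  have hc : ∀ c : ℝ, Ord atTop (fun n : ℕ => (n : ℝ)⁻¹) 0 fun _ : ℕ => c := Ord.const hh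
  have M : ∀ (c : ℝ) {g : ℕ → ℝ}, Ord atTop (fun n : ℕ => (n : ℝ)⁻¹) 0 g →
      Ord atTop (fun n : ℕ => (n : ℝ)⁻¹) 0 fun n => c * g n := fun c _ hg =>
    HasJet.mul_zero_ord hh (hc c) hg
  have x1 : Ord atTop (fun n : ℕ => (n : ℝ)⁻¹) 0 (seriesArg ε K) :=
    M _ ((M _ ord_log).add (hc K))
  have P : ∀ k : ℕ, Ord atTop (fun n : ℕ => (n : ℝ)⁻¹) 0 fun n => seriesArg ε K n ^ k :=
    fun k => by simpa using x1.pow hh k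
  refine ⟨hc 1, x1, ((M _ (P 2)).add (M _ x1)).add (hc _),
    (((M _ (P 3)).add (M _ (P 2))).add (M _ x1)).add (hc _),
    ((((M _ (P 4)).add (M _ (P 3))).add (M _ (P 2))).add (M _ x1)).sub (hc _), hc 0,
    Ord.of_isBigO hh ?_⟩
  simpa [seriesVal] using isBigO_zero _ _

theorem tendsto_seriesVal (ε K : ℝ) : Tendsto (seriesVal ε K) atTop (𝓝 1) :=
  (hasJet_seriesVal ε K).tendsto_one tendsto_natCast_inv fun _ => rfl

/-- `abelFun_rescale` with `h = 1 / n` and `z = b₁ ln n + K`, which is `-2` times the argument of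
the `P_m`: then `-b₁ ln h - z` reduces to `-K`. Vanishing of the first five coefficients gives order
`5`, hence order `4` after removing `h v²`. -/
theorem abelFun_series {ε : ℝ} (hε : ε = 1 ∨ ε = -1) (K : ℝ) :
    (fun n : ℕ => abelFun (3 / 20 * ε) (47 / 2800) (-3 / 16000 * ε) (-83723 / 86240000)
      (n / seriesVal ε K n ^ 2) - n - K) =o[atTop] fun n : ℕ => (n : ℝ) ^ (-3 : ℝ) := by
  have hh := tendsto_natCast_inv
  have hv := hasJet_seriesVal ε K
  have x1 : Ord atTop (fun n : ℕ => (n : ℝ)⁻¹) 0 fun n => -2 * seriesArg ε K n :=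
    HasJet.mul_zero_ord hh (Ord.const hh (-2)) hv.ord1
  have key := hasJet_abelFun (b := 3 / 20 * ε) (c₁ := 47 / 2800) (c₂ := -3 / 16000 * ε)
    (c₃ := -83723 / 86240000) hh hv (fun _ => rfl) (HasJet.const hh x1)
  have hJ := fun n => abelJet_series hε (seriesArg ε K n)
  have h5 := key.ord_five hh (fun n => (hJ n).1) (fun n => (hJ n).2.1) (fun n => (hJ n).2.2.1)
    (fun n => (hJ n).2.2.2.1) (fun n => (hJ n).2.2.2.2)
  have h4 := ord_of_scale_mul hh (tendsto_seriesVal ε K) (k := 4) (by norm_num; exact h5)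
  refine (h4.isLittleO hh (m := 3) (by norm_num)).congr (fun n => ?_) fun n => ?_
  · rw [Real.log_inv, show (1 : ℝ) / ((n : ℝ)⁻¹ * seriesVal ε K n ^ 2) = n / seriesVal ε K n ^ 2 by
      rw [one_div, mul_inv, inv_inv, div_eq_mul_inv], seriesArg, one_div, inv_inv]
    ring
  · rw [Real.inv_rpow (Nat.cast_nonneg n), ← Real.rpow_neg (Nat.cast_nonneg n)]

/-- A sequence with `x² = 3 / (2 y)` is determined up to `o(n ^ (-9/2))` by `y` up to
`o(n ^ (-3))`. -/
theorem isLittleO_sub_of_inv_sq {x y v : ℕ → ℝ} (hx : ∀ n, 0 < x n)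
    (hy : ∀ n, y n = 1 / (2 / 3 * x n ^ 2)) (hdiv : Tendsto (fun n : ℕ => y n / n) atTop (𝓝 1))
    (hv : Tendsto v atTop (𝓝 1))
    (hyv : (fun n : ℕ => y n - n / v n ^ 2) =o[atTop] fun n : ℕ => (n : ℝ) ^ (-3 : ℝ)) :
    (fun n : ℕ => x n - √(3 / 2 / n) * v n) =o[atTop] fun n : ℕ => (n : ℝ) ^ (-(9 / 2) : ℝ) := by
  have hy1 : (fun n => (y n)⁻¹) =O[atTop] fun n : ℕ => (n : ℝ) ^ (-1 : ℝ) := by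
    have h := (hdiv.inv₀ one_ne_zero).isBigO_one ℝ
    refine (h.mul (isBigO_refl (fun n : ℕ => (n : ℝ) ^ (-1 : ℝ)) atTop)).congr' ?_ ?_
    · filter_upwards [eventually_gt_atTop 0] with n hn
      have : (n : ℝ) ≠ 0 := by exact_mod_cast hn.ne'
      rw [Real.rpow_neg_one]
      field_simp
    · exact Eventually.of_forall fun n => one_mul _
  have hz1 : (fun n : ℕ => v n ^ 2 / n) =O[atTop] fun n : ℕ => (n : ℝ) ^ (-1 : ℝ) := by
    have h := (hv.pow 2).isBigO_one ℝ
    refine (h.mul (isBigO_refl (fun n : ℕ => (n : ℝ) ^ (-1 : ℝ)) atTop)).congr ?_ ?_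
    · intro n
      rw [Real.rpow_neg_one, div_eq_mul_inv]
    · intro n
      exact one_mul _
  -- Since `x n > 0`, and eventually `v n > 1/2`, the sum is at least `1 / (2 √n)`.
  have hs1 : (fun n : ℕ => (x n + √(3 / 2 / n) * v n)⁻¹) =O[atTop]
      fun n : ℕ => (n : ℝ) ^ (1 / 2 : ℝ) := by
    refine IsBigO.of_bound 2 ?_
    filter_upwards [eventually_gt_atTop 0,
      hv.eventually (lt_mem_nhds (show (1 / 2 : ℝ) < 1 by norm_num))] with n hn hvn
    have hn0 : (0 : ℝ) < n := by exact_mod_cast hn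
    have h1 : 1 / √n ≤ √(3 / 2 / n) := by
      rw [one_div, ← Real.sqrt_inv]
      refine Real.sqrt_le_sqrt ?_
      rw [inv_eq_one_div]
      gcongr
      norm_num
    have h2 : 1 / √n * (1 / 2) ≤ x n + √(3 / 2 / n) * v n := by
      have : 1 / √n * (1 / 2) ≤ √(3 / 2 / n) * v n :=
        mul_le_mul h1 hvn.le (by norm_num) (Real.sqrt_nonneg _)
      linarith [hx n]
    have h3 : 0 < √(n : ℝ) := Real.sqrt_pos.2 hn0
    have h4 : 0 < x n + √(3 / 2 / n) * v n := lt_of_lt_of_le (by positivity) h2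
    rw [← Real.sqrt_eq_rpow, Real.norm_of_nonneg (inv_nonneg.2 h4.le), Real.norm_of_nonneg h3.le]
    refine (inv_anti₀ (by positivity) h2).trans (le_of_eq ?_)
    field_simp
  -- With `s = √(3 / 2 / n)`, `x - s v = (x² - s² v²) / (x + s v)` and `x² - s² v² = -(3/2) (y - n /
  -- v²) (1 / y) (v² / n)`. The exponents add up to `-3 - 1 - 1 + 1/2 = -9/2`.
  have key := (((hyv.mul_isBigO hy1).mul_isBigO hz1).mul_isBigO hs1).const_mul_left (-(3 / 2))
  refine key.congr' ?_ ?_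
  · filter_upwards [eventually_gt_atTop 0,
      hv.eventually (lt_mem_nhds (show (1 / 2 : ℝ) < 1 by norm_num))] with n hn hvn
    have hn0 : (0 : ℝ) < n := by exact_mod_cast hn
    have hv0 : 0 < v n := by linarith
    have hs : 0 ≤ √(3 / 2 / (n : ℝ)) := Real.sqrt_nonneg _
    have hpos : 0 < x n + √(3 / 2 / n) * v n := by
      have := hx n
      positivity
    have hsq : √(3 / 2 / (n : ℝ)) ^ 2 = 3 / 2 / n := Real.sq_sqrt (by positivity)
    have hx2 : x n ≠ 0 := (hx n).ne'
    have hfac : x n - √(3 / 2 / n) * v n =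
        (x n ^ 2 - √(3 / 2 / (n : ℝ)) ^ 2 * v n ^ 2) * (x n + √(3 / 2 / n) * v n)⁻¹ := by
      rw [← div_eq_mul_inv, eq_div_iff hpos.ne']
      ring
    rw [hfac, hsq, hy n, ← mul_assoc]
    congr 1
    field_simp
    ring
  · filter_upwards [eventually_gt_atTop 0] with n hn
    have hn0 : (0 : ℝ) < n := by exact_mod_cast hn
    rw [← Real.rpow_add hn0, ← Real.rpow_add hn0, ← Real.rpow_add hn0]
    norm_num

theorem exists_iterate_expansion {f : ℝ → ℝ} {a : ℕ → ℚ} (hf : TaylorStart f 2 a)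
    (hc : Continuous f) (hpos : ∀ x, 0 < x → 0 < f x) (hlt : ∀ x, 0 < x → f x < x)
    {ε : ℝ} (hε : ε = 1 ∨ ε = -1)
    (hJ : abelJet (3 / 20 * ε) (47 / 2800) (-3 / 16000 * ε) (-83723 / 86240000)
      ⟨1, a 1 * (3 / 2), a 2 * (3 / 2) ^ 2, a 3 * (3 / 2) ^ 3, a 4 * (3 / 2) ^ 4,
        a 5 * (3 / 2) ^ 5⟩
      ⟨1, 47 / 2800, -3 / 16000 * ε, -83723 / 86240000, 0, 0⟩ = ⟨0, 0, 0, 0, 0, 0⟩)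
    {x₀ : ℝ} (hx₀ : 0 < x₀) :
    ∃ K : ℝ, (fun n : ℕ => f^[n] x₀ - √(3 / 2 / n) * seriesVal ε K n)
      =o[atTop] fun n : ℕ => (n : ℝ) ^ (-(9 / 2) : ℝ) := by
  have hx := tendsto_iterate_zero hc hpos hlt hx₀
  have hΦ := (abelFun_diff_ord tendsto_scale hf.hasJet (fun _ => rfl) fun _ => hJ).congr'
    (g := fun x => abelFun (3 / 20 * ε) (47 / 2800) (-3 / 16000 * ε) (-83723 / 86240000)
      (1 / (2 / 3 * f x ^ 2)) - abelFun (3 / 20 * ε) (47 / 2800) (-3 / 16000 * ε)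
      (-83723 / 86240000) (1 / (2 / 3 * x ^ 2)) - 1) (by
    filter_upwards [self_mem_nhdsWithin] with x hx
    have : x ≠ 0 := (show (0 : ℝ) < x from hx).ne'
    rw [show 2 / 3 * x ^ 2 * (f x / x) ^ 2 = 2 / 3 * f x ^ 2 by field_simp])
  obtain ⟨hdiv, K, hK⟩ := exists_abelFun_iterate hx
    (fun n => Function.iterate_succ_apply' f n x₀) hΦ
  refine ⟨K, isLittleO_sub_of_inv_sq (iterate_pos hpos hx₀) (fun _ => rfl) hdiv
    (tendsto_seriesVal ε K) ?_⟩
  -- The same `K` is used in the candidate, so that `n + K` cancels and `A yₙ - A zₙ = o(n⁻³)`.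
  have hdiff := hK.sub (abelFun_series hε K)
  obtain ⟨Y, hY⟩ := exists_abelFun_expanding (3 / 20 * ε) (47 / 2800) (-3 / 16000 * ε)
    (-83723 / 86240000)
  have hz : Tendsto (fun n : ℕ => (n : ℝ) / seriesVal ε K n ^ 2) atTop atTop :=
    (tendsto_natCast_atTop_atTop (R := ℝ)).atTop_mul_pos one_pos
      (by simpa using ((tendsto_seriesVal ε K).pow 2).inv₀ (by norm_num))
  refine IsBigO.trans_isLittleO (IsBigO.of_bound 2 ?_) hdiff
  filter_upwards [(tendsto_iterate_inv_sq hx).eventually_ge_atTop Y,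
    hz.eventually_ge_atTop Y] with n h1 h2
  refine (hY _ _ h1 h2).trans (le_of_eq ?_)
  rw [Real.norm_eq_abs]
  congr 2
  ring

end Expansion

/-! ### Application to `tanh` and `arctan`, and the explicit coefficients. -/

section Main

theorem tanh_pos {x : ℝ} (hx : 0 < x) : 0 < Real.tanh x := by
  rw [Real.tanh_eq_sinh_div_cosh]
  exact div_pos (Real.sinh_pos_iff.2 hx) (Real.cosh_pos x)

theorem tanh_lt_self {x : ℝ} (hx : 0 < x) : Real.tanh x < x := by
  have hd : ∀ y, HasDerivAt (fun y => y - Real.tanh y) (1 - (1 - Real.tanh y ^ 2)) y := fun y =>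
    (hasDerivAt_id y).sub (hasDerivAt_tanh y)
  have hmono : StrictMonoOn (fun y => y - Real.tanh y) (Set.Ici 0) := by
    refine strictMonoOn_of_deriv_pos (convex_Ici 0)
      (fun y _ => (hd y).continuousAt.continuousWithinAt) fun y hy => ?_
    rw [interior_Ici] at hy
    rw [(hd y).deriv]
    have := tanh_pos hy
    nlinarith
  have := hmono (Set.self_mem_Ici) hx.le hx
  simp at this
  exact this

theorem arctan_lt_self {x : ℝ} (hx : 0 < x) : Real.arctan x < x := by
  have h := Real.lt_tan (Real.arctan_pos.2 hx) (Real.arctan_lt_pi_div_two x)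
  rwa [Real.tan_arctan] at h

theorem continuous_tanh : Continuous Real.tanh :=
  continuous_iff_continuousAt.2 fun x => (hasDerivAt_tanh x).continuousAt

theorem formulaSum_tanhA (K : ℝ) (n : ℕ) :
    formulaSum 2 tanhA 4 K n = √(3 / 2 / n) * seriesVal 1 K n := by
  rw [formulaSum, lam_tanhA, coeffB_tanhA.1, Real.sqrt_eq_rpow]
  simp only [Finset.sum_Icc_succ_top, Nat.reduceLeDiff, Nat.reduceAdd, Finset.Icc_self,
    Finset.sum_singleton, polyP_one, polyP_tanhA_two, polyP_tanhA_three, polyP_tanhA_four,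
      seriesVal, seriesJet, Jet.eval,
    seriesArg]
  congr 1
  · norm_num
  · simp
    ring

theorem formulaSum_arctanA (K : ℝ) (n : ℕ) :
    formulaSum 2 arctanA 4 K n = √(3 / 2 / n) * seriesVal (-1) K n := by
  rw [formulaSum, lam_arctanA, coeffB_arctanA.1, Real.sqrt_eq_rpow]
  simp only [Finset.sum_Icc_succ_top, Nat.reduceLeDiff, Nat.reduceAdd, Finset.Icc_self,
    Finset.sum_singleton, polyP_one, polyP_arctanA_two, polyP_arctanA_three, polyP_arctanA_four,
      seriesVal, seriesJet,
    Jet.eval, seriesArg]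
  congr 1
  · norm_num
  · simp
    ring

theorem expansion_eq (w : ℕ → ℕ → ℝ) {n : ℕ} (hn : 0 < n) :
    expansion w n = (√(n : ℝ))⁻¹ * ∑ m ∈ Finset.range 5, (∑ j ∈ Finset.range (m + 1),
      w m j * Real.log n ^ j) * (n : ℝ)⁻¹ ^ m := by
  have hn0 : (0 : ℝ) < n := by exact_mod_cast hn
  rw [expansion, Finset.mul_sum]
  refine Finset.sum_congr rfl fun m _ => ?_
  rw [Finset.sum_mul, Finset.mul_sum]
  refine Finset.sum_congr rfl fun j _ => ?_
  rw [Real.rpow_add hn0, Real.rpow_natCast, ← Real.sqrt_eq_rpow, inv_pow, div_eq_mul_inv, mul_inv]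
  ring

theorem sqrt_div_sqrt (n : ℕ) (v : ℝ) : √(3 / 2 / n) * v / √(3 / 2) = (√(n : ℝ))⁻¹ * v := by
  have h : √(3 / 2 : ℝ) ≠ 0 := (Real.sqrt_pos.2 (by norm_num)).ne'
  rw [Real.sqrt_div (by norm_num), div_eq_mul_inv _ √(n : ℝ), mul_assoc, 
    mul_div_cancel_left₀ _ h]

theorem expansion_tanhCoeff (K : ℝ) {n : ℕ} (hn : 0 < n) :
    expansion (tanhCoeff K) n = √(3 / 2 / n) * seriesVal 1 K n / √(3 / 2) := by
  rw [sqrt_div_sqrt, expansion_eq _ hn]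
  congr 1
  simp only [Finset.sum_range_succ, Finset.sum_range_zero, tanhCoeff, seriesVal, seriesJet,
    Jet.eval, seriesArg]
  ring

/-- For `arctan` the coefficient `b₁` is negative. Replacing `K` by `-K` makes the argument of the
`P_m` equal to `(3/20 ln n + K) / 2`, the negative of the one for `tanh`, so the coefficients match
up to `(-1) ^ m`. -/
theorem expansion_arctanCoeff (K : ℝ) {n : ℕ} (hn : 0 < n) :
    expansion (arctanCoeff K) n = √(3 / 2 / n) * seriesVal (-1) (-K) n / √(3 / 2) := by
  rw [sqrt_div_sqrt, expansion_eq _ hn]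
  congr 1
  simp only [Finset.sum_range_succ, Finset.sum_range_zero, arctanCoeff, seriesVal, seriesJet,
    Jet.eval, seriesArg]
  ring

theorem isLittleO_div_sqrt {x g e : ℕ → ℝ} {k : ℝ}
    (h : (fun n => x n - g n) =o[atTop] fun n : ℕ => (n : ℝ) ^ k)
    (he : ∀ n : ℕ, 0 < n → e n = g n / √(3 / 2)) :
    (fun n => x n / √(3 / 2) - e n) =o[atTop] fun n : ℕ => (n : ℝ) ^ k := by
  refine (h.const_mul_left (√(3 / 2))⁻¹).congr' ?_ EventuallyEq.rfl
  filter_upwards [eventually_gt_atTop 0] with n hn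
  rw [he n hn]
  ring

/-- The hypothesis stands inside the existential so that `choose` yields a constant defined for all
real `x₀`; its value `0` for `x₀ ≤ 0` is irrelevant. -/
theorem tanh_expansion (x₀ : ℝ) : ∃ K : ℝ, 0 < x₀ →
    (fun n : ℕ => Real.tanh^[n] x₀ - √(3 / 2 / n) * seriesVal 1 K n)
      =o[atTop] fun n : ℕ => (n : ℝ) ^ (-(9 / 2) : ℝ) := by
  by_cases hx : 0 < x₀
  · obtain ⟨K, hK⟩ := exists_iterate_expansion taylorStart_tanh continuous_tanh
      (fun _ => tanh_pos) (fun _ => tanh_lt_self) (ε := 1) (Or.inl rfl) (by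
        have := abelJet_tanh
        norm_num [tanhA] at this ⊢
        exact this) hx
    exact ⟨K, fun _ => hK⟩
  · exact ⟨0, fun h => absurd h hx⟩

theorem arctan_expansion (x₀ : ℝ) : ∃ K : ℝ, 0 < x₀ →
    (fun n : ℕ => Real.arctan^[n] x₀ - √(3 / 2 / n) * seriesVal (-1) (-K) n)
      =o[atTop] fun n : ℕ => (n : ℝ) ^ (-(9 / 2) : ℝ) := by
  by_cases hx : 0 < x₀
  · obtain ⟨K, hK⟩ := exists_iterate_expansion taylorStart_arctan Real.continuous_arctan
      (fun _ => Real.arctan_pos.2) (fun _ => arctan_lt_self) (ε := -1) (Or.inr rfl) (by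
        have := abelJet_arctan
        norm_num [arctanA] at this ⊢
        exact this) hx
    exact ⟨-K, fun _ => by simpa using hK⟩
  · exact ⟨0, fun h => absurd h hx⟩

end Main

end Iterates

theorem mainTheorem8 :
    -- the parameters that the algorithm attaches to `tanh`
    (Iterates.TaylorStart Real.tanh 2 Iterates.tanhA ∧
      Iterates.lam 2 Iterates.tanhA = 3 / 2 ∧
      (fun j : Fin 6 => Iterates.coeffB 2 Iterates.tanhA (j + 1)) =
        ![3 / 20, -1 / 28, 3 / 400, -9 / 6160, 691 / 2548000, -3 / 61600] ∧
      (fun j : Fin 6 => Iterates.coeffA 2 Iterates.tanhA 0 (j + 1)) =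
        ![1, -7 / 20, 31 / 210, -381 / 5600, 73 / 2200, -1414477 / 84084000] ∧
      (fun i : Fin 5 => Iterates.coeffC 2 Iterates.tanhA (i + 1)) =
        ![47 / 2800, -3 / 16000, -83723 / 86240000, -27832729 / 89689600000,
          2800730629 / 15695680000000] ∧
      Iterates.polyT 2 Iterates.tanhA 2 = C (3 / 20) * X - C (47 / 2800) ∧
      Iterates.polyT 2 Iterates.tanhA 3 =
        -C (3 / 40) * X ^ 2 + C (11 / 280) * X - C (261 / 112000) ∧
      Iterates.polyT 2 Iterates.tanhA 4 =
        C (1 / 20) * X ^ 3 - C (283 / 5600) * X ^ 2 + C (591 / 56000) * X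
          + C (58557 / 172480000) ∧
      Iterates.polyP 2 Iterates.tanhA 2 =
        C (3 / 2) * X ^ 2 + C (3 / 20) * X + C (47 / 5600) ∧
      Iterates.polyP 2 Iterates.tanhA 3 =
        C (5 / 2) * X ^ 3 + C (3 / 5) * X ^ 2 + C (361 / 5600) * X + C (261 / 224000) ∧
      Iterates.polyP 2 Iterates.tanhA 4 =
        C (35 / 8) * X ^ 4 + C (71 / 40) * X ^ 3 + C (101 / 320) * X ^ 2
          + C (3993 / 224000) * X - C (44217 / 689920000)) ∧
    -- the expansion of the iterates of `tanh`, through the polynomials `P_m` and explicitly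
    (∃ K : ℝ → ℝ, ∀ x₀ : ℝ, 0 < x₀ →
      ((fun n : ℕ => Real.tanh^[n] x₀ - Iterates.formulaSum 2 Iterates.tanhA 4 (K x₀) n)
        =o[atTop] fun n : ℕ => (n : ℝ) ^ (-(9 / 2) : ℝ)) ∧
      ((fun n : ℕ => Real.tanh^[n] x₀ / √(3 / 2)
          - Iterates.expansion (Iterates.tanhCoeff (K x₀)) n)
        =o[atTop] fun n : ℕ => (n : ℝ) ^ (-(9 / 2) : ℝ))) ∧
    -- the expansion of the iterates of `arctan`, with the constant taken with the opposite sign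
    (Iterates.TaylorStart Real.arctan 2 Iterates.arctanA ∧
      ∃ K : ℝ → ℝ, ∀ x₀ : ℝ, 0 < x₀ →
      ((fun n : ℕ => Real.arctan^[n] x₀ - Iterates.formulaSum 2 Iterates.arctanA 4 (-K x₀) n)
        =o[atTop] fun n : ℕ => (n : ℝ) ^ (-(9 / 2) : ℝ)) ∧
      ((fun n : ℕ => Real.arctan^[n] x₀ / √(3 / 2)
          - Iterates.expansion (Iterates.arctanCoeff (K x₀)) n)
        =o[atTop] fun n : ℕ => (n : ℝ) ^ (-(9 / 2) : ℝ))) ∧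
    -- up to signs, all corresponding coefficients for `tanh` and `arctan` agree
    ((∀ i ∈ Finset.Icc 1 5, Iterates.coeffC 2 Iterates.tanhA i =
        (-1) ^ (i + 1) * Iterates.coeffC 2 Iterates.arctanA i) ∧
      (∀ m ∈ Finset.Icc 1 4, ∀ k : ℕ, (Iterates.polyT 2 Iterates.tanhA m).coeff k =
        (-1) ^ (m + k) * (Iterates.polyT 2 Iterates.arctanA m).coeff k) ∧
      (∀ m ∈ Finset.Icc 1 4, ∀ k : ℕ, (Iterates.polyP 2 Iterates.tanhA m).coeff k =
        (-1) ^ (m + k) * (Iterates.polyP 2 Iterates.arctanA m).coeff k) ∧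
      (∀ (K : ℝ) (m j : ℕ), Iterates.tanhCoeff K m j =
        (-1) ^ m * Iterates.arctanCoeff K m j)) := by
  refine ⟨⟨Iterates.taylorStart_tanh, Iterates.lam_tanhA, ?_, ?_, ?_, Iterates.polyT_tanhA_two,
    Iterates.polyT_tanhA_three, Iterates.polyT_tanhA_four, Iterates.polyP_tanhA_two,
    Iterates.polyP_tanhA_three, Iterates.polyP_tanhA_four⟩, ?_, ⟨Iterates.taylorStart_arctan, ?_⟩,
    Iterates.coeffC_tanhA_eq, Iterates.polyT_tanhA_coeff, Iterates.polyP_tanhA_coeff,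
    Iterates.tanhCoeff_eq⟩
  · funext j
    fin_cases j <;> simp [Iterates.coeffB_tanhA]
  · funext j
    fin_cases j <;> simp [Iterates.coeffA_zero_tanhA]
  · funext j
    fin_cases j <;> simp [Iterates.coeffC_tanhA_one, Iterates.coeffC_tanhA_two,
      Iterates.coeffC_tanhA_three, Iterates.coeffC_tanhA_four, Iterates.coeffC_tanhA_five]
  · choose K hK using Iterates.tanh_expansion
    refine ⟨K, fun x₀ hx₀ => ⟨?_, ?_⟩⟩
    · simpa only [Iterates.formulaSum_tanhA] using hK x₀ hx₀
    · exact Iterates.isLittleO_div_sqrt (hK x₀ hx₀) fun n hn =>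
        Iterates.expansion_tanhCoeff (K x₀) hn
  · choose K hK using Iterates.arctan_expansion
    refine ⟨K, fun x₀ hx₀ => ⟨?_, ?_⟩⟩
    · simpa only [Iterates.formulaSum_arctanA] using hK x₀ hx₀
    · exact Iterates.isLittleO_div_sqrt (hK x₀ hx₀) fun n hn =>
        Iterates.expansion_arctanCoeff (K x₀) hn
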